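/- **Setting.** Let $d\in\mathbb N$, $T\ge 0$, $\gamma\in(0,1)$ and let $\mathbf n$ be the integer part of $1/\gamma$. Let $\mathscr T_d\subset\mathscr F_d$ be the sets of nonplanar rooted trees and forests with vertices decorated by $\{1,\dots,d\}$; $\mathscr F_d$ is the free commutative monoid on $\mathscr T_d$ with product $\odot$ and unit the empty forest $\mathbf 1$; $|\zeta|$ is the number of vertices of $\zeta$; $\lfloor\zeta\rfloor_i$ is the tree obtained by joining the trees of $\zeta$ to a new root decorated by $i$; $\mathscr F_d^n=\{\zeta\in\mathscr F_d:|\zeta|\le n\}$ and $\mathscr T_d^n=\mathscr T_d\cap\mathscr F_d^n$. Write $\langle S\rangle$ for the real vector space with basis $S$. The Connes–Kreimer coproduct $\Delta_\star:\langle\mathscr F_d\rangle\to\langle\mathscr F_d\rangle\otimes\langle\mathscr F_d\rangle$ is the linear map given by $\Delta_\star\mathbf 1=\mathbf 1\otimes\mathbf 1$, $\Delta_\star\lfloor\zeta\rfloor_i=\lfloor\zeta\rfloor_i\otimes\mathbf 1+(\mathrm{id}\otimes\lfloor\cdot\rfloor_i)\Delta_\star\zeta$ and $\Delta_\star(\zeta_1\odot\zeta_2)=\Delta_\star\zeta_1\cdot\Delta_\star\zeta_2$;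 write $\Delta_\star\zeta=\sum_{C,T}c(\zeta;C,T)\,C\otimes T$ with $C,T\in\mathscr F_d$. Let $\varepsilon(\zeta)=\delta_{\mathbf 1,\zeta}$, $\varepsilon_n=\varepsilon|_{\langle\mathscr F_d^n\rangle}$ and $\langle\zeta,\eta\rangle=\delta_{\zeta,\eta}$ for forests $\zeta,\eta$. On the space $\overline{\langle\mathscr F_d\rangle}$ of formal series of forests, $\star$ is the Grossman–Larson product, the bilinear extension of $C\star T=\sum_{\zeta}c(\zeta;C,T)\,\zeta$; $\pi^n$ is the projection of formal series onto $\langle\mathscr F_d^n\rangle$, $\star_n$ the truncated product $x\star_n y=\pi^n(x\star y)$, and $\Delta_\odot\zeta=\sum_{\zeta_1\odot\zeta_2=\zeta}\zeta_1\otimes\zeta_2$, extended to formal series. Let $$\bar G_d=\{g\in\overline{\langle\mathscr F_d\rangle}\setminus\{0\}:\Delta_\odot g=g\otimes g\},\qquad G_d^n=\{g\in\langle\mathscr F_d^n\rangle\setminus\{0\}:\Delta_\odot g=\pi^n(g\otimes g)\},$$ where $\pi^n(g\otimes g)$ is the part of total degree at most $n$. For $g\in G_d^n$ with $\log_{\star_n}g=\sum_{\tau\in\mathscr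 T_d^n}b_\tau\tau$ put $\|g\|_{G^n_d}=\sum_{\tau\in\mathscr T_d^n}|b_\tau|^{1/|\tau|}$. Define four sets. * $\mathscr R^\gamma$: maps $\mathbf X:[0,T]\to G_d^{\mathbf n}$ with $\mathbf X_0=\mathbf 1$ and $\sup_{s<t}\|\mathbf X_{st}\|_{G_d^{\mathbf n}}/|t-s|^\gamma<\infty$, where $\mathbf X_{st}=\mathbf X_s^{\star_{\mathbf n}-1}\star_{\mathbf n}\mathbf X_t$. * $\bar{\mathscr R}^\gamma$: maps $\bar{\mathbf X}:[0,T]\to\bar G_d$ with $\bar{\mathbf X}_0=\mathbf 1$ and $\sup_{s<t}\|\pi^n\bar{\mathbf X}_{st}\|_{G_d^n}/|t-s|^\gamma<\infty$ for every $n\in\mathbb N$, where $\bar{\mathbf X}_{st}=\bar{\mathbf X}_s^{\star-1}\star\bar{\mathbf X}_t$. * $\check{\mathscr R}^\gamma$: maps $\check{\mathbf X}:[0,T]^2\to\langle\mathscr F_d^{\mathbf n}\rangle^*$ (algebraic dual) such that for all $s,u,t\in[0,T]$: (1) $\check{\mathbf X}_{st}(\mathbf 1)=1$ and $\check{\mathbf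 X}_{st}(\zeta_1\odot\zeta_2)=\check{\mathbf X}_{st}(\zeta_1)\check{\mathbf X}_{st}(\zeta_2)$ whenever $|\zeta_1|+|\zeta_2|\le\mathbf n$; (2) $\check{\mathbf X}_{tt}=\varepsilon_{\mathbf n}$ and $\check{\mathbf X}_{st}(\zeta)=(\check{\mathbf X}_{su}\otimes\check{\mathbf X}_{ut})\Delta_\star\zeta$ for $\zeta\in\mathscr F_d^{\mathbf n}$; (3) $\sup_{s\ne t}|\check{\mathbf X}_{st}(\zeta)|/|t-s|^{\gamma|\zeta|}<\infty$ for $\zeta\in\mathscr F_d^{\mathbf n}$. * $\hat{\mathscr R}^\gamma$: maps $\hat{\mathbf X}:[0,T]^2\to\langle\mathscr F_d\rangle^*$ satisfying the same three conditions with $\varepsilon$ in place of $\varepsilon_{\mathbf n}$ and for all forests in $\mathscr F_d$, without restriction on their size. **Theorem.** The maps $$I_1^\gamma:\bar{\mathscr R}^\gamma\to\mathscr R^\gamma,\ \bar{\mathbf X}\mapsto\mathbf X,\ \mathbf X_t:=\pi^{\mathbf n}\bar{\mathbf X}_t,$$ $$I_2^\gamma:\mathscr R^\gamma\to\check{\mathscr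 R}^\gamma,\ \mathbf X\mapsto\check{\mathbf X},\ \check{\mathbf X}_{st}(y):=\langle y,\mathbf X_{st}\rangle,$$ $$I_3^\gamma:\bar{\mathscr R}^\gamma\to\hat{\mathscr R}^\gamma,\ \bar{\mathbf X}\mapsto\hat{\mathbf X},\ \hat{\mathbf X}_{st}(y):=\langle y,\bar{\mathbf X}_{st}\rangle$$ are well-defined and bijective. -/

import Mathlib

namespace BranchedRP

open scoped TensorProduct

/-! ### Decorated trees and forests -/

/-- The functor `X ↦ {1, …, d} × Multiset X`; decorated nonplanar rooted trees are its initial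
algebra: a tree consists of the decoration of its root together with the multiset of the subtrees
above the root. -/
def TreeF (d : ℕ) (X : Type) : Type := Fin d × Multiset X

noncomputable instance TreeF.qpf (d : ℕ) : QPF (TreeF d) where
  map f x := (x.1, x.2.map f)
  P := ⟨Fin d × ℕ, fun a => Fin a.2⟩
  abs x := (x.1.1, (List.ofFn x.2 : Multiset _))
  repr x := ⟨(x.1, x.2.toList.length), x.2.toList.get⟩
  abs_repr x := by
    obtain ⟨i, m⟩ := x
    change (i, ((List.ofFn m.toList.get : List _) : Multiset _)) = (i, m)
    rw [List.ofFn_get, Multiset.coe_toList]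
  abs_map f p := by
    obtain ⟨a, g⟩ := p
    change (a.1, ((List.ofFn (f ∘ g) : List _) : Multiset _)) =
      (a.1, (((List.ofFn g : List _) : Multiset _)).map f)
    rw [Multiset.map_coe, List.map_ofFn]

/-- The set `𝒯_d` of nonplanar rooted trees with vertices decorated by `{1, …, d}`. -/
def Tree (d : ℕ) : Type := QPF.Fix (TreeF d)

/-- The set `ℱ_d` of decorated forests: the free commutative monoid on `𝒯_d`. The product
`ζ₁ ⊙ ζ₂` of forests is `ζ₁ + ζ₂`, the empty forest `𝟏` is `0`. -/
abbrev Forest (d : ℕ) : Type := Multiset (Tree d)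

/-- `⌊ζ⌋_i`: join the trees of the forest `ζ` to a new root decorated by `i`. -/
noncomputable def Tree.node {d : ℕ} (i : Fin d) (ζ : Forest d) : Tree d :=
  QPF.Fix.mk (F := TreeF d) (i, ζ)

/-- Recursion over trees. -/
noncomputable def Tree.fold {d : ℕ} {α : Type} (g : Fin d → Multiset α → α) (τ : Tree d) : α :=
  QPF.Fix.rec (F := TreeF d) (fun x => g x.1 x.2) τ

theorem Tree.fold_node {d : ℕ} {α : Type} (g : Fin d → Multiset α → α) (i : Fin d)
    (ζ : Forest d) : (Tree.node i ζ).fold g = g i (ζ.map (Tree.fold g)) :=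
  QPF.Fix.rec_eq (F := TreeF d) (fun x => g x.1 x.2) (i, ζ)

theorem Tree.induction {d : ℕ} {p : Tree d → Prop}
    (h : ∀ i (ζ : Forest d), (∀ τ ∈ ζ, p τ) → p (Tree.node i ζ)) (τ : Tree d) : p τ := by
  refine QPF.Fix.ind (F := TreeF d) p ?_ τ
  rintro ⟨i, ζ⟩ ⟨⟨j, u⟩, hu⟩
  have h2 : ζ = Multiset.map Subtype.val u := (congrArg Prod.snd hu).symm
  refine h i ζ fun τ hτ => ?_
  obtain ⟨σ, -, rfl⟩ := Multiset.mem_map.1 (h2 ▸ hτ : τ ∈ Multiset.map Subtype.val u)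
  exact σ.2

theorem Tree.node_bijective {d : ℕ} :
    Function.Bijective fun x : Fin d × Forest d => Tree.node x.1 x.2 :=
  ⟨fun x y h => by
      have := congrArg (QPF.Fix.dest (F := TreeF d)) h
      exact (QPF.Fix.dest_mk (F := TreeF d) x).symm.trans
        (this.trans (QPF.Fix.dest_mk (F := TreeF d) y)),
    fun τ => ⟨QPF.Fix.dest (F := TreeF d) τ, QPF.Fix.mk_dest (F := TreeF d) τ⟩⟩

/-- The number `|τ|` of vertices of a tree. -/
noncomputable def Tree.size {d : ℕ} (τ : Tree d) : ℕ :=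
  τ.fold fun _ m => m.sum + 1

/-- The number `|ζ|` of vertices of a forest. -/
noncomputable def Forest.size {d : ℕ} (ζ : Forest d) : ℕ :=
  (ζ.map Tree.size).sum

theorem Tree.size_node {d : ℕ} (i : Fin d) (ζ : Forest d) :
    (Tree.node i ζ).size = Forest.size ζ + 1 :=
  Tree.fold_node _ i ζ

theorem Forest.size_zero {d : ℕ} : Forest.size (0 : Forest d) = 0 := by
  simp [Forest.size]

theorem Forest.size_add {d : ℕ} (ζ₁ ζ₂ : Forest d) :
    Forest.size (ζ₁ + ζ₂) = Forest.size ζ₁ + Forest.size ζ₂ := by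
  simp [Forest.size]

theorem Forest.size_singleton {d : ℕ} (τ : Tree d) :
    Forest.size ({τ} : Forest d) = τ.size := by
  simp [Forest.size]

/-- The set `𝒯_d^n` of trees with at most `n` vertices. -/
abbrev TreeLE (d n : ℕ) : Type := {τ : Tree d // τ.size ≤ n}

/-- The set `ℱ_d^n` of forests with at most `n` vertices. -/
abbrev ForestLE (d n : ℕ) : Type := {ζ : Forest d // Forest.size ζ ≤ n}

theorem Tree.one_le_size {d : ℕ} (τ : Tree d) : 1 ≤ τ.size := by
  induction τ using Tree.induction with
  | h i ζ _ => rw [Tree.size_node]; omega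

theorem Forest.size_le_of_mem {d : ℕ} {ζ : Forest d} {τ : Tree d} (h : τ ∈ ζ) :
    τ.size ≤ Forest.size ζ :=
  Multiset.single_le_sum (fun _ _ => Nat.zero_le _) _ (Multiset.mem_map_of_mem _ h)

theorem Forest.card_le_size {d : ℕ} (ζ : Forest d) : ζ.card ≤ Forest.size ζ := by
  have := Multiset.card_nsmul_le_sum (s := ζ.map Tree.size) (a := 1) (by
    intro x hx
    obtain ⟨τ, -, rfl⟩ := Multiset.mem_map.1 hx
    exact τ.one_le_size)
  simpa [Forest.size] using this

theorem Forest.finite_of_tree {d n : ℕ} (h : {τ : Tree d | τ.size ≤ n}.Finite) :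
    {ζ : Forest d | Forest.size ζ ≤ n}.Finite := by
  classical
  refine (Set.finite_Iic (n • h.toFinset.val)).subset fun ζ hζ => ?_
  rw [Set.mem_Iic, Multiset.le_iff_count]
  intro τ
  by_cases hτ : τ ∈ ζ
  · have h1 : τ ∈ h.toFinset := by
      simpa using (Forest.size_le_of_mem hτ).trans hζ
    have h2 : Multiset.count τ h.toFinset.val = 1 :=
      Multiset.count_eq_one_of_mem h.toFinset.nodup h1
    rw [Multiset.count_nsmul, h2, mul_one]
    exact ((Multiset.count_le_card _ _).trans (Forest.card_le_size ζ)).trans hζ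
  · rw [Multiset.count_eq_zero_of_notMem hτ]
    exact Nat.zero_le _

theorem Tree.finite_size_le (d n : ℕ) : {τ : Tree d | τ.size ≤ n}.Finite := by
  induction n with
  | zero =>
    convert Set.finite_empty
    ext τ
    have := τ.one_le_size
    simp only [Set.mem_ofPred_eq, Set.mem_empty_iff_false, iff_false]
    omega
  | succ n ih =>
    refine ((Set.finite_univ.prod (Forest.finite_of_tree ih)).image
      fun x : Fin d × Forest d => Tree.node x.1 x.2).subset fun τ hτ => ?_
    obtain ⟨⟨i, ζ⟩, rfl⟩ := Tree.node_bijective.2 τ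
    refine ⟨(i, ζ), ⟨Set.mem_univ _, ?_⟩, rfl⟩
    have : (Tree.node i ζ).size ≤ n + 1 := hτ
    rw [Tree.size_node] at this
    exact Nat.le_of_succ_le_succ this

noncomputable instance TreeLE.fintype (d n : ℕ) : Fintype (TreeLE d n) :=
  (Tree.finite_size_le d n).fintype

noncomputable instance ForestLE.fintype (d n : ℕ) : Fintype (ForestLE d n) :=
  (Forest.finite_of_tree (Tree.finite_size_le d n)).fintype

/-! ### The Connes–Kreimer coproduct -/

/-- The commutative algebra `(⟨ℱ_d⟩, ⊙)` of real linear combinations of forests. -/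
abbrev CK (d : ℕ) : Type := AddMonoidAlgebra ℝ (Forest d)

/-- The forest `ζ` as an element of `⟨ℱ_d⟩`. -/
noncomputable def CK.of {d : ℕ} (ζ : Forest d) : CK d := AddMonoidAlgebra.single ζ 1

/-- The basis `ℱ_d` of `⟨ℱ_d⟩`. -/
noncomputable def CK.basis (d : ℕ) : Module.Basis (Forest d) ℝ (CK d) :=
  AddMonoidAlgebra.basis (Forest d) ℝ

theorem CK.basis_apply {d : ℕ} (ζ : Forest d) : CK.basis d ζ = CK.of ζ := by
  simp [CK.basis, CK.of]

/-- The linear extension of `⌊·⌋_i` to `⟨ℱ_d⟩`. -/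
noncomputable def CK.graft {d : ℕ} (i : Fin d) : CK d →ₗ[ℝ] CK d :=
  (CK.basis d).constr ℝ fun ζ => CK.of {Tree.node i ζ}

/-- Auxiliary recursion computing the pair `(τ, Δ⋆ τ)`. -/
noncomputable def Tree.coprodAux {d : ℕ} (τ : Tree d) : Tree d × (CK d ⊗[ℝ] CK d) :=
  τ.fold fun i m =>
    (Tree.node i (m.map Prod.fst),
      CK.of {Tree.node i (m.map Prod.fst)} ⊗ₜ[ℝ] (1 : CK d) +
        (CK.graft i).lTensor (CK d) (m.map Prod.snd).prod)

/-- `Δ⋆ τ` for a tree `τ`. -/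
noncomputable def Tree.coprod {d : ℕ} (τ : Tree d) : CK d ⊗[ℝ] CK d := τ.coprodAux.2

/-- `Δ⋆ ζ` for a forest `ζ`: the product of the `Δ⋆ τ` over the trees of `ζ`. -/
noncomputable def Forest.coprod {d : ℕ} (ζ : Forest d) : CK d ⊗[ℝ] CK d :=
  (ζ.map Tree.coprod).prod

/-- The Connes–Kreimer coproduct `Δ⋆` (crowns of the cuts on the left, trunks on the right). -/
noncomputable def CK.coprod (d : ℕ) : CK d →ₗ[ℝ] CK d ⊗[ℝ] CK d :=
  (CK.basis d).constr ℝ Forest.coprod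

theorem Tree.coprodAux_fst {d : ℕ} (τ : Tree d) : τ.coprodAux.1 = τ := by
  induction τ using Tree.induction with
  | h i ζ ih =>
    rw [Tree.coprodAux, Tree.fold_node]
    change Tree.node i ((ζ.map Tree.coprodAux).map Prod.fst) = _
    rw [Multiset.map_map]
    congr 1
    conv_rhs => rw [← Multiset.map_id ζ]
    exact Multiset.map_congr rfl ih

theorem CK.coprod_of {d : ℕ} (ζ : Forest d) : CK.coprod d (CK.of ζ) = Forest.coprod ζ := by
  rw [← CK.basis_apply, CK.coprod, Module.Basis.constr_basis]

theorem CK.coprod_one (d : ℕ) : CK.coprod d (CK.of 0) = CK.of 0 ⊗ₜ[ℝ] CK.of 0 := by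
  rw [CK.coprod_of]
  simp only [Forest.coprod, Multiset.map_zero, Multiset.prod_zero]
  rfl

theorem CK.coprod_graft {d : ℕ} (i : Fin d) (ζ : Forest d) :
    CK.coprod d (CK.of {Tree.node i ζ}) =
      CK.of {Tree.node i ζ} ⊗ₜ[ℝ] CK.of 0 +
        (CK.graft i).lTensor (CK d) (CK.coprod d (CK.of ζ)) := by
  rw [CK.coprod_of, CK.coprod_of]
  have h1 : ((ζ.map Tree.coprodAux).map Prod.fst) = ζ := by
    rw [Multiset.map_map]
    conv_rhs => rw [← Multiset.map_id ζ]
    exact Multiset.map_congr rfl fun τ _ => τ.coprodAux_fst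
  have h2 : (ζ.map Tree.coprodAux).map Prod.snd = ζ.map Tree.coprod := by
    rw [Multiset.map_map]; rfl
  have h3 : (Tree.node i ζ).coprod =
      CK.of {Tree.node i ((ζ.map Tree.coprodAux).map Prod.fst)} ⊗ₜ[ℝ] (1 : CK d) +
        (CK.graft i).lTensor (CK d) ((ζ.map Tree.coprodAux).map Prod.snd).prod := by
    rw [Tree.coprod, Tree.coprodAux, Tree.fold_node]; rfl
  rw [h1, h2] at h3
  simp only [Forest.coprod, Multiset.map_singleton, Multiset.prod_singleton]
  exact h3

theorem CK.coprod_mul {d : ℕ} (ζ₁ ζ₂ : Forest d) :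
    CK.coprod d (CK.of ζ₁ * CK.of ζ₂) = CK.coprod d (CK.of ζ₁) * CK.coprod d (CK.of ζ₂) := by
  have : CK.of ζ₁ * CK.of ζ₂ = CK.of (ζ₁ + ζ₂) := by
    simp [CK.of, AddMonoidAlgebra.single_mul_single]
  rw [this, CK.coprod_of, CK.coprod_of, CK.coprod_of]
  simp [Forest.coprod]

/-- The counit `ε(ζ) = δ_{𝟏,ζ}`. -/
noncomputable def CK.counit (d : ℕ) : Module.Dual ℝ (CK d) := (CK.basis d).coord 0

/-- The cut multiplicities `(C, T) ↦ c(ζ; C, T)`, so `Δ⋆ ζ = ∑_{C,T} c(ζ; C, T) C ⊗ T`. -/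
noncomputable def cutCoeff {d : ℕ} (ζ : Forest d) : (Forest d × Forest d) →₀ ℝ :=
  ((CK.basis d).tensorProduct (CK.basis d)).repr (CK.coprod d (CK.of ζ))

/-- `(f ⊗ g) : ⟨ℱ_d⟩ ⊗ ⟨ℱ_d⟩ → ℝ` for linear functionals `f, g`. -/
noncomputable def tensorDual {d : ℕ} (f g : Module.Dual ℝ (CK d)) : CK d ⊗[ℝ] CK d →ₗ[ℝ] ℝ :=
  LinearMap.mul' ℝ ℝ ∘ₗ TensorProduct.map f g

/-! ### The Grossman–Larson product on formal series -/

/-- Formal series `∑_ζ x_ζ ζ` of forests, given by their coefficients. (For every degree there are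
only finitely many forests, so this is `∏_n ⟨ℱ_{d,n}⟩`.) -/
abbrev Series (d : ℕ) : Type := Forest d → ℝ

/-- Elements `∑_{|ζ| ≤ n} x_ζ ζ` of `⟨ℱ_d^n⟩`, given by their coefficients. -/
abbrev TruncSeries (d n : ℕ) : Type := ForestLE d n → ℝ

/-- The projection `π^n`, which forgets all forests with more than `n` vertices. -/
def proj {d : ℕ} (n : ℕ) (x : Series d) : TruncSeries d n := fun ζ => x ζ.1

open Classical in
/-- The inclusion of `⟨ℱ_d^n⟩` into the space of formal series. -/
noncomputable def incl {d n : ℕ} (x : TruncSeries d n) : Series d :=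
  fun ζ => if h : Forest.size ζ ≤ n then x ⟨ζ, h⟩ else 0

open Classical in
/-- The series `𝟏`. -/
noncomputable def unit (d : ℕ) : Series d := fun ζ => if ζ = 0 then 1 else 0

/-- The element `𝟏` of `⟨ℱ_d^n⟩`. -/
noncomputable def unitTrunc (d n : ℕ) : TruncSeries d n := proj n (unit d)

/-- The Grossman–Larson product of formal series, the (infinite) bilinear extension of
`C ⋆ T = ∑_ζ c(ζ; C, T) ζ`. -/
noncomputable def glMul {d : ℕ} (x y : Series d) : Series d :=
  fun ζ => (cutCoeff ζ).sum fun p c => c * (x p.1 * y p.2)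

/-- The truncated Grossman–Larson product `⋆_n`. -/
noncomputable def glMulTrunc {d n : ℕ} (x y : TruncSeries d n) : TruncSeries d n :=
  proj n (glMul (incl x) (incl y))

open Classical in
/-- The inverse `x^{⋆ -1}` (and `0` if `x` has no inverse). -/
noncomputable def glInv {d : ℕ} (x : Series d) : Series d :=
  if h : ∃ y, glMul x y = unit d ∧ glMul y x = unit d then h.choose else 0

open Classical in
/-- The inverse `x^{⋆_n -1}` (and `0` if `x` has no inverse). -/
noncomputable def glInvTrunc {d n : ℕ} (x : TruncSeries d n) : TruncSeries d n :=
  if h : ∃ y, glMulTrunc x y = unitTrunc d n ∧ glMulTrunc y x = unitTrunc d n then h.choose else 0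

/-- The powers `u^{⋆_n k}`. -/
noncomputable def glPowTrunc {d n : ℕ} (u : TruncSeries d n) : ℕ → TruncSeries d n
  | 0 => unitTrunc d n
  | k + 1 => glMulTrunc (glPowTrunc u k) u

/-- The logarithm `log_{⋆_n}(𝟏 + u) = ∑_{k ≥ 1} (-1)^{k-1} u^{⋆_n k} / k`, applied to elements
whose coefficient at the empty forest is `1`; the terms with `k > n` then vanish. -/
noncomputable def glLogTrunc {d n : ℕ} (x : TruncSeries d n) : TruncSeries d n :=
  ∑ k ∈ Finset.Icc 1 n, ((-1 : ℝ) ^ (k + 1) / k) • glPowTrunc (x - unitTrunc d n) k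

/-! ### Group-like elements -/

/-- The coproduct `Δ_⊙ ζ = ∑_{ζ₁ ⊙ ζ₂ = ζ} ζ₁ ⊗ ζ₂`, extended to formal series: the coefficient
of `ζ₁ ⊗ ζ₂` in `Δ_⊙ x` is that of `ζ₁ ⊙ ζ₂` in `x`. -/
def forestCoprod {d : ℕ} (x : Series d) : Forest d × Forest d → ℝ := fun p => x (p.1 + p.2)

/-- The coefficients of `x ⊗ y`. -/
def tensorSeries {d : ℕ} (x y : Series d) : Forest d × Forest d → ℝ := fun p => x p.1 * y p.2

open Classical in
/-- The projection of formal series of tensors onto total degree at most `n`. -/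
noncomputable def projTensor {d : ℕ} (n : ℕ) (z : Forest d × Forest d → ℝ) :
    Forest d × Forest d → ℝ :=
  fun p => if Forest.size p.1 + Forest.size p.2 ≤ n then z p else 0

/-- The group of group-like formal series. -/
def groupLike (d : ℕ) : Set (Series d) :=
  {g | g ≠ 0 ∧ forestCoprod g = tensorSeries g g}

/-- The truncated group-like elements: `Δ_⊙ g = π^n (g ⊗ g)`. -/
def groupLikeTrunc (d n : ℕ) : Set (TruncSeries d n) :=
  {g | g ≠ 0 ∧ forestCoprod (incl g) = projTensor n (tensorSeries (incl g) (incl g))}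

/-- The homogeneous norm
`‖exp_{⋆_n} (∑_{τ ∈ 𝒯_d^n} b_τ τ)‖ = ∑_{τ ∈ 𝒯_d^n} |b_τ|^{1/|τ|}`. -/
noncomputable def hNorm {d n : ℕ} (g : TruncSeries d n) : ℝ :=
  ∑ τ : TreeLE d n,
    |glLogTrunc g ⟨{τ.1}, (Forest.size_singleton τ.1).trans_le τ.2⟩| ^ (1 / (τ.1.size : ℝ))

/-! ### The four notions of branched rough path -/

/-- The integer part of `1 / γ`. -/
noncomputable def order (γ : ℝ) : ℕ := ⌊1 / γ⌋₊

/-- `X_{st} = X_s^{⋆ -1} ⋆ X_t`. -/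
noncomputable def incr {d : ℕ} {T : ℝ} (X : Set.Icc 0 T → Series d) (s t : Set.Icc 0 T) :
    Series d :=
  glMul (glInv (X s)) (X t)

/-- `X_{st} = X_s^{⋆_n -1} ⋆_n X_t`. -/
noncomputable def incrTrunc {d n : ℕ} {T : ℝ} (X : Set.Icc 0 T → TruncSeries d n)
    (s t : Set.Icc 0 T) : TruncSeries d n :=
  glMulTrunc (glInvTrunc (X s)) (X t)

/-- Truncated Grossman–Larson group-like branched rough paths. -/
def truncPaths (d : ℕ) (T γ : ℝ) : Set (Set.Icc 0 T → TruncSeries d (order γ)) :=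
  {X | (∀ t, X t ∈ groupLikeTrunc d (order γ)) ∧
    (∀ t : Set.Icc 0 T, (t : ℝ) = 0 → X t = unitTrunc d (order γ)) ∧
    ∃ K : ℝ, ∀ s t : Set.Icc 0 T, s < t →
      hNorm (incrTrunc X s t) / |(t : ℝ) - s| ^ γ ≤ K}

/-- Full Grossman–Larson group-like branched rough paths. -/
def fullPaths (d : ℕ) (T γ : ℝ) : Set (Set.Icc 0 T → Series d) :=
  {X | (∀ t, X t ∈ groupLike d) ∧
    (∀ t : Set.Icc 0 T, (t : ℝ) = 0 → X t = unit d) ∧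
    ∀ n : ℕ, ∃ K : ℝ, ∀ s t : Set.Icc 0 T, s < t →
      hNorm (proj n (incr X s t)) / |(t : ℝ) - s| ^ γ ≤ K}

/-- The vector space `⟨ℱ_d^n⟩`, as the domain of truncated characters. -/
abbrev CKTrunc (d n : ℕ) : Type := ForestLE d n →₀ ℝ

/-- The forest `ζ` with at most `n` vertices as an element of `⟨ℱ_d^n⟩`. -/
noncomputable def CKTrunc.of {d n : ℕ} (ζ : ForestLE d n) : CKTrunc d n := Finsupp.single ζ 1

open Classical in
/-- The projection of `⟨ℱ_d⟩` onto `⟨ℱ_d^n⟩`. -/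
noncomputable def CKTrunc.proj (d n : ℕ) : CK d →ₗ[ℝ] CKTrunc d n :=
  (CK.basis d).constr ℝ fun ζ =>
    if h : Forest.size ζ ≤ n then CKTrunc.of ⟨ζ, h⟩ else 0

/-- The empty forest as an element of `ℱ_d^n`. -/
def ForestLE.empty (d n : ℕ) : ForestLE d n := ⟨0, Forest.size_zero.trans_le (Nat.zero_le n)⟩

/-- The counit `ε_n` on `⟨ℱ_d^n⟩`. -/
noncomputable def CKTrunc.counit (d n : ℕ) : Module.Dual ℝ (CKTrunc d n) :=
  Finsupp.lapply (ForestLE.empty d n)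

/-- Truncated character-valued branched rough paths. Since `Δ⋆ ζ` only involves forests with at
most `|ζ| ≤ n` vertices, `(X_{su} ⊗ X_{ut}) Δ⋆ ζ` may be computed after extending the functionals
`X_{su}, X_{ut}` on `⟨ℱ_d^n⟩` to `⟨ℱ_d⟩` by means of the projection. -/
def truncChars (d : ℕ) (T γ : ℝ) :
    Set (Set.Icc 0 T → Set.Icc 0 T → Module.Dual ℝ (CKTrunc d (order γ))) :=
  {X |
    (∀ s t, X s t (CKTrunc.of (ForestLE.empty d (order γ))) = 1 ∧
      ∀ (ζ₁ ζ₂ : ForestLE d (order γ)) (h : Forest.size (ζ₁.1 + ζ₂.1) ≤ order γ),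
        X s t (CKTrunc.of ⟨ζ₁.1 + ζ₂.1, h⟩) = X s t (CKTrunc.of ζ₁) * X s t (CKTrunc.of ζ₂)) ∧
    ((∀ t, X t t = CKTrunc.counit d (order γ)) ∧
      ∀ (s u t : Set.Icc 0 T) (ζ : ForestLE d (order γ)),
        X s t (CKTrunc.of ζ) =
          tensorDual (X s u ∘ₗ CKTrunc.proj d (order γ)) (X u t ∘ₗ CKTrunc.proj d (order γ))
            (CK.coprod d (CK.of ζ.1))) ∧
    ∀ ζ : ForestLE d (order γ), ∃ K : ℝ, ∀ s t : Set.Icc 0 T, s ≠ t →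
      |X s t (CKTrunc.of ζ)| / |(t : ℝ) - s| ^ (γ * (Forest.size ζ.1 : ℝ)) ≤ K}

/-- Full character-valued branched rough paths. -/
def fullChars (d : ℕ) (T γ : ℝ) :
    Set (Set.Icc 0 T → Set.Icc 0 T → Module.Dual ℝ (CK d)) :=
  {X |
    (∀ s t, X s t (CK.of 0) = 1 ∧
      ∀ ζ₁ ζ₂ : Forest d, X s t (CK.of ζ₁ * CK.of ζ₂) = X s t (CK.of ζ₁) * X s t (CK.of ζ₂)) ∧
    ((∀ t, X t t = CK.counit d) ∧
      ∀ (s u t : Set.Icc 0 T) (ζ : Forest d),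
        X s t (CK.of ζ) = tensorDual (X s u) (X u t) (CK.coprod d (CK.of ζ))) ∧
    ∀ ζ : Forest d, ∃ K : ℝ, ∀ s t : Set.Icc 0 T, s ≠ t →
      |X s t (CK.of ζ)| / |(t : ℝ) - s| ^ (γ * (Forest.size ζ : ℝ)) ≤ K}

/-! ### The comparison maps -/

/-- The functional `⟨·, x⟩` on `⟨ℱ_d⟩` given by a formal series `x`, where `⟨ζ, η⟩ = δ_{ζ,η}`. -/
noncomputable def pairing {d : ℕ} (x : Series d) : Module.Dual ℝ (CK d) :=
  (CK.basis d).constr ℝ x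

/-- The functional `⟨·, x⟩` on `⟨ℱ_d^n⟩` given by an element `x` of `⟨ℱ_d^n⟩`. -/
noncomputable def pairingTrunc {d n : ℕ} (x : TruncSeries d n) : Module.Dual ℝ (CKTrunc d n) :=
  Finsupp.linearCombination ℝ x

/-- `I₁`: truncation, `X_t = π^n X̄_t`. -/
noncomputable def truncMap (d : ℕ) (T γ : ℝ) (X : Set.Icc 0 T → Series d) :
    Set.Icc 0 T → TruncSeries d (order γ) :=
  fun t => proj (order γ) (X t)

/-- `I₂`: pairing with the increments of a truncated path. -/
noncomputable def pairTruncMap (d : ℕ) (T γ : ℝ) (X : Set.Icc 0 T → TruncSeries d (order γ)) :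
    Set.Icc 0 T → Set.Icc 0 T → Module.Dual ℝ (CKTrunc d (order γ)) :=
  fun s t => pairingTrunc (incrTrunc X s t)

/-- `I₃`: pairing with the increments of a full path. -/
noncomputable def pairFullMap (d : ℕ) (T : ℝ) (X : Set.Icc 0 T → Series d) :
    Set.Icc 0 T → Set.Icc 0 T → Module.Dual ℝ (CK d) :=
  fun s t => pairing (incr X s t)

end BranchedRP

namespace BranchedRP

open scoped TensorProduct

/-! ### The bialgebra of forests -/

/-! A group-like series is a character of the forest algebra, so its values on trees are free and
determine it, and the Grossman–Larson product is convolution of characters along `Δ⋆`.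
Coassociativity and the counit laws, checked on grafted trees through `CK.algHom_ext_graft`, make
the product associative and unital. Because `Δ⋆` preserves the number of vertices,
`glMul_eq_add_glRest` splits a product at a forest into the two trivial cuts and a remainder that
sees only strictly smaller forests. This triangular structure gives inverses
(`GroupLike.exists_mul_eq_one`), and truncated group-like elements are exactly the projections of
elements of the resulting group.

All four kinds of rough path are then encoded by paths `Y` in this group starting at the identity,
considered up to order `order γ` or to all orders. The regularity conditions all become
`LevelBound`: the logarithm is the identity on trees up to lower-order terms, so the homogeneous
norm is equivalent to homogeneous bounds on coefficients, and these may be checked forest by forest.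
Chen's relation says that a two-parameter family of characters consists of the increments of its
section at time 0. Hence `I₂` and `I₃` are bijective, the inverse being evaluation at `s = 0`.

Bijectivity of `I₁` is Lyons' extension theorem. On trees of size `n + 1` the increments are
additive up to a defect of size `|t - s|^(γ(n+1))`, with exponent above 1 once `n ≥ order γ`. The
sewing lemma `exists_sewing` provides the correction to the next order. Conversely, two extensions
that agree up to order `n` differ on a tree of size `n + 1` by a function of Hölder exponent above
1, which is constant by `eq_of_abs_sub_le_rpow`. -/

theorem CK.of_zero (d : ℕ) : CK.of (0 : Forest d) = 1 := rfl

theorem CK.of_add {d : ℕ} (ζ₁ ζ₂ : Forest d) : CK.of (ζ₁ + ζ₂) = CK.of ζ₁ * CK.of ζ₂ := by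
  simp [CK.of, AddMonoidAlgebra.single_mul_single]

theorem CK.graft_of {d : ℕ} (i : Fin d) (ζ : Forest d) :
    CK.graft i (CK.of ζ) = CK.of {Tree.node i ζ} := by
  rw [← CK.basis_apply, CK.graft, Module.Basis.constr_basis]

/-- Algebra homomorphisms from `⟨ℱ_d⟩` which agree on trees agree on forests. -/
theorem CK.algHom_of_eq {d : ℕ} {A : Type*} [Semiring A] [Algebra ℝ A] {φ ψ : CK d →ₐ[ℝ] A}
    {ζ : Forest d} (h : ∀ τ ∈ ζ, φ (CK.of {τ}) = ψ (CK.of {τ})) :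
    φ (CK.of ζ) = ψ (CK.of ζ) := by
  induction ζ using Multiset.induction_on with
  | empty => rw [CK.of_zero, map_one, map_one]
  | cons τ ζ ih =>
    rw [← Multiset.singleton_add, CK.of_add, map_mul, map_mul, h τ (Multiset.mem_cons_self τ ζ),
      ih fun σ hσ => h σ (Multiset.mem_cons_of_mem hσ)]

theorem CK.algHom_ext {d : ℕ} {A : Type*} [Semiring A] [Algebra ℝ A] {φ ψ : CK d →ₐ[ℝ] A}
    (h : ∀ ζ, φ (CK.of ζ) = ψ (CK.of ζ)) : φ = ψ := by
  apply AlgHom.toLinearMap_injective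
  refine (CK.basis d).ext fun ζ => ?_
  rw [CK.basis_apply]
  exact h ζ

/-- Induction principle for identities between algebra homomorphisms from `⟨ℱ_d⟩`. -/
theorem CK.algHom_ext_graft {d : ℕ} {A : Type*} [Semiring A] [Algebra ℝ A] {φ ψ : CK d →ₐ[ℝ] A}
    (h : ∀ i ζ, φ (CK.of ζ) = ψ (CK.of ζ) →
      φ (CK.graft i (CK.of ζ)) = ψ (CK.graft i (CK.of ζ))) : φ = ψ := by
  refine CK.algHom_ext fun ζ => CK.algHom_of_eq fun τ hτ => ?_
  clear hτ
  induction τ using Tree.induction with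
  | h i ζ ih =>
    rw [← CK.graft_of]
    exact h i ζ (CK.algHom_of_eq ih)

/-- The algebra homomorphism on `⟨ℱ_d⟩` extending a multiplicative map on forests. -/
noncomputable def CK.lift {d : ℕ} {A : Type*} [Semiring A] [Algebra ℝ A] (f : Forest d → A)
    (h0 : f 0 = 1) (hadd : ∀ ζ₁ ζ₂, f (ζ₁ + ζ₂) = f ζ₁ * f ζ₂) : CK d →ₐ[ℝ] A :=
  AddMonoidAlgebra.lift ℝ A (Forest d)
    { toFun := fun ζ => f ζ.toAdd, map_one' := h0, map_mul' := fun x y => hadd x.toAdd y.toAdd }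

theorem CK.lift_of {d : ℕ} {A : Type*} [Semiring A] [Algebra ℝ A] (f : Forest d → A)
    (h0 : f 0 = 1) (hadd : ∀ ζ₁ ζ₂, f (ζ₁ + ζ₂) = f ζ₁ * f ζ₂) (ζ : Forest d) :
    CK.lift f h0 hadd (CK.of ζ) = f ζ := by
  simp [CK.lift, CK.of, AddMonoidAlgebra.lift_single]

theorem Forest.coprod_zero {d : ℕ} : Forest.coprod (0 : Forest d) = 1 := by simp [Forest.coprod]

theorem Forest.coprod_add {d : ℕ} (ζ₁ ζ₂ : Forest d) :
    Forest.coprod (ζ₁ + ζ₂) = Forest.coprod ζ₁ * Forest.coprod ζ₂ := by simp [Forest.coprod]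

/-- `Δ⋆` as an algebra homomorphism. -/
noncomputable def CK.coprodHom (d : ℕ) : CK d →ₐ[ℝ] CK d ⊗[ℝ] CK d :=
  CK.lift Forest.coprod Forest.coprod_zero Forest.coprod_add

theorem CK.coprodHom_toLinearMap (d : ℕ) : (CK.coprodHom d).toLinearMap = CK.coprod d := by
  refine (CK.basis d).ext fun ζ => ?_
  rw [CK.basis_apply, CK.coprod_of]
  exact CK.lift_of _ Forest.coprod_zero Forest.coprod_add ζ

theorem CK.coprodHom_apply {d : ℕ} (x : CK d) : CK.coprodHom d x = CK.coprod d x :=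
  LinearMap.congr_fun (CK.coprodHom_toLinearMap d) x

/-! ### Cocycle identity for grafting, coassociativity and counit laws -/

theorem CK.coprod_graft_apply {d : ℕ} (i : Fin d) (x : CK d) :
    CK.coprod d (CK.graft i x) =
      CK.graft i x ⊗ₜ[ℝ] 1 + (CK.graft i).lTensor (CK d) (CK.coprod d x) := by
  have : CK.coprod d ∘ₗ CK.graft i =
      (TensorProduct.mk ℝ (CK d) (CK d)).flip 1 ∘ₗ CK.graft i +
        (CK.graft i).lTensor (CK d) ∘ₗ CK.coprod d := by
    refine (CK.basis d).ext fun ζ => ?_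
    simp only [CK.basis_apply, LinearMap.comp_apply, LinearMap.add_apply, LinearMap.flip_apply,
      TensorProduct.mk_apply, CK.graft_of]
    exact CK.coprod_graft i ζ
  exact LinearMap.congr_fun this x

/-- Grafting acts on the trunk factor and the outer coproduct on the crown factor, so the two
operations commute. -/
theorem CK.coassoc_graft_aux {d : ℕ} (i : Fin d) (z : CK d ⊗[ℝ] CK d) :
    TensorProduct.assoc ℝ (CK d) (CK d) (CK d)
        ((CK.coprod d).rTensor (CK d) ((CK.graft i).lTensor (CK d) z)) =
      ((CK.graft i).lTensor (CK d)).lTensor (CK d)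
        (TensorProduct.assoc ℝ (CK d) (CK d) (CK d) ((CK.coprod d).rTensor (CK d) z)) := by
  induction z with
  | zero => simp
  | add x y hx hy => simp only [map_add, hx, hy]
  | tmul x y =>
    simp only [LinearMap.lTensor_tmul, LinearMap.rTensor_tmul]
    induction CK.coprod d x with
    | zero => simp
    | add x y hx hy => simp only [map_add, TensorProduct.add_tmul, hx, hy]
    | tmul x y => simp

/-- Both sides are algebra homomorphisms, so it suffices to propagate the identity from a forest to
its grafting, where the cocycle identity applies. -/
theorem CK.coassoc {d : ℕ} (x : CK d) :
    TensorProduct.assoc ℝ (CK d) (CK d) (CK d) ((CK.coprod d).rTensor (CK d) (CK.coprod d x)) =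
      (CK.coprod d).lTensor (CK d) (CK.coprod d x) := by
  have key : (Algebra.TensorProduct.assoc ℝ ℝ ℝ (CK d) (CK d) (CK d)).toAlgHom.comp
      ((Algebra.TensorProduct.map (CK.coprodHom d) (AlgHom.id ℝ (CK d))).comp (CK.coprodHom d)) =
      (Algebra.TensorProduct.map (AlgHom.id ℝ (CK d)) (CK.coprodHom d)).comp
        (CK.coprodHom d) := by
    have e1 : ∀ y, ((Algebra.TensorProduct.assoc ℝ ℝ ℝ (CK d) (CK d) (CK d)).toAlgHom.comp
      ((Algebra.TensorProduct.map (CK.coprodHom d) (AlgHom.id ℝ (CK d))).comp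
        (CK.coprodHom d))) y = TensorProduct.assoc ℝ (CK d) (CK d) (CK d)
          ((CK.coprod d).rTensor (CK d) (CK.coprod d y)) := fun y => by
      rw [← CK.coprodHom_toLinearMap]; rfl
    have e2 : ∀ y, ((Algebra.TensorProduct.map (AlgHom.id ℝ (CK d)) (CK.coprodHom d)).comp
        (CK.coprodHom d)) y = (CK.coprod d).lTensor (CK d) (CK.coprod d y) := fun y => by
      rw [← CK.coprodHom_toLinearMap]; rfl
    refine CK.algHom_ext_graft fun i ζ ih => ?_
    rw [e1, e2] at ih ⊢
    set x := CK.of ζ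
    -- The cocycle identity in the right tensor factor; its first summand matches the term that the
    -- left side gets from `⌊ζ⌋_i ⊗ 𝟏`.
    have h1 : ∀ z : CK d ⊗[ℝ] CK d, (CK.coprod d).lTensor (CK d)
        ((CK.graft i).lTensor (CK d) z) =
        TensorProduct.assoc ℝ (CK d) (CK d) (CK d) ((CK.graft i).lTensor (CK d) z ⊗ₜ 1) +
          ((CK.graft i).lTensor (CK d)).lTensor (CK d) ((CK.coprod d).lTensor (CK d) z) := by
      intro z
      induction z with
      | zero => simp
      | add x y hx hy =>
        simp only [map_add, TensorProduct.add_tmul, hx, hy]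
        abel
      | tmul x y =>
        simp [CK.coprod_graft_apply, TensorProduct.tmul_add]
    rw [CK.coprod_graft_apply, map_add, map_add, CK.coassoc_graft_aux, ih, map_add, h1,
      LinearMap.rTensor_tmul, LinearMap.lTensor_tmul, CK.coprod_graft_apply,
      TensorProduct.add_tmul, map_add, TensorProduct.assoc_tmul, ← CK.of_zero, CK.coprod_one]
    abel
  have := congrArg (fun φ => φ x) key
  have h2 := CK.coprodHom_toLinearMap d
  rw [← h2]
  exact this

/-- The counit as an algebra homomorphism. -/
noncomputable def CK.counitHom (d : ℕ) : CK d →ₐ[ℝ] ℝ :=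
  CK.lift (unit d) (by simp [unit]) fun ζ₁ ζ₂ => by
    by_cases h1 : ζ₁ = 0 <;> by_cases h2 : ζ₂ = 0 <;> simp [unit, h1, h2]

theorem CK.counitHom_of {d : ℕ} (ζ : Forest d) : CK.counitHom d (CK.of ζ) = unit d ζ :=
  CK.lift_of _ _ _ ζ

theorem CK.counitHom_graft {d : ℕ} (i : Fin d) (x : CK d) :
    CK.counitHom d (CK.graft i x) = 0 := by
  have : (CK.counitHom d).toLinearMap ∘ₗ CK.graft i = 0 := by
    refine (CK.basis d).ext fun ζ => ?_
    simp [CK.basis_apply, CK.graft_of, CK.counitHom_of, unit]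
  exact LinearMap.congr_fun this x

theorem CK.counit_coprod {d : ℕ} (x : CK d) :
    TensorProduct.lid ℝ (CK d)
      ((CK.counitHom d).toLinearMap.rTensor (CK d) (CK.coprod d x)) = x := by
  have key : (Algebra.TensorProduct.lid ℝ (CK d)).toAlgHom.comp
      ((Algebra.TensorProduct.map (CK.counitHom d) (AlgHom.id ℝ (CK d))).comp
        (CK.coprodHom d)) = AlgHom.id ℝ (CK d) := by
    have e1 : ∀ y, ((Algebra.TensorProduct.lid ℝ (CK d)).toAlgHom.comp
      ((Algebra.TensorProduct.map (CK.counitHom d) (AlgHom.id ℝ (CK d))).comp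
        (CK.coprodHom d))) y = TensorProduct.lid ℝ (CK d)
      ((CK.counitHom d).toLinearMap.rTensor (CK d) (CK.coprod d y)) := fun y => by
      rw [← CK.coprodHom_toLinearMap]; rfl
    refine CK.algHom_ext_graft fun i ζ ih => ?_
    rw [e1, AlgHom.id_apply] at ih ⊢
    have h1 : ∀ z : CK d ⊗[ℝ] CK d, TensorProduct.lid ℝ (CK d)
        ((CK.counitHom d).toLinearMap.rTensor (CK d) ((CK.graft i).lTensor (CK d) z)) =
        CK.graft i (TensorProduct.lid ℝ (CK d)
          ((CK.counitHom d).toLinearMap.rTensor (CK d) z)) := by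
      intro z
      induction z with
      | zero => simp
      | add x y hx hy => simp only [map_add, hx, hy]
      | tmul x y => simp
    rw [CK.coprod_graft_apply, map_add, map_add, h1, ih]
    simp [CK.counitHom_graft]
  have := congrArg (fun φ => φ x) key
  rw [← CK.coprodHom_toLinearMap d]
  exact this

/-- The counit kills every grafted trunk, so on a tree only the cut with empty trunk survives. -/
theorem CK.coprod_counit {d : ℕ} (x : CK d) :
    TensorProduct.rid ℝ (CK d)
      ((CK.counitHom d).toLinearMap.lTensor (CK d) (CK.coprod d x)) = x := by
  have key : (Algebra.TensorProduct.rid ℝ ℝ (CK d)).toAlgHom.comp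
      ((Algebra.TensorProduct.map (AlgHom.id ℝ (CK d)) (CK.counitHom d)).comp
        (CK.coprodHom d)) = AlgHom.id ℝ (CK d) := by
    have e1 : ∀ y, ((Algebra.TensorProduct.rid ℝ ℝ (CK d)).toAlgHom.comp
      ((Algebra.TensorProduct.map (AlgHom.id ℝ (CK d)) (CK.counitHom d)).comp
        (CK.coprodHom d))) y = TensorProduct.rid ℝ (CK d)
      ((CK.counitHom d).toLinearMap.lTensor (CK d) (CK.coprod d y)) := fun y => by
      rw [← CK.coprodHom_toLinearMap]; rfl
    refine CK.algHom_ext_graft fun i ζ ih => ?_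
    rw [e1, AlgHom.id_apply] at ih ⊢
    have h1 : ∀ z : CK d ⊗[ℝ] CK d,
        (CK.counitHom d).toLinearMap.lTensor (CK d) ((CK.graft i).lTensor (CK d) z) = 0 := by
      intro z
      induction z with
      | zero => simp
      | add x y hx hy => simp only [map_add, hx, hy, add_zero]
      | tmul x y => simp [CK.counitHom_graft]
    rw [CK.coprod_graft_apply, map_add, map_add, h1]
    simp
  have := congrArg (fun φ => φ x) key
  rw [← CK.coprodHom_toLinearMap d]
  exact this

/-! ### The grading of the coproduct -/

/-- The algebra endomorphism `ζ ↦ 2^{|ζ|} ζ`. -/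
noncomputable def CK.dilation (d : ℕ) : CK d →ₐ[ℝ] CK d :=
  CK.lift (fun ζ => (2 : ℝ) ^ Forest.size ζ • CK.of ζ) (by simp [Forest.size_zero, CK.of_zero])
    fun ζ₁ ζ₂ => by
      rw [Forest.size_add, CK.of_add, pow_add, smul_mul_smul_comm]

theorem CK.dilation_of {d : ℕ} (ζ : Forest d) :
    CK.dilation d (CK.of ζ) = (2 : ℝ) ^ Forest.size ζ • CK.of ζ :=
  CK.lift_of _ _ _ ζ

theorem CK.dilation_graft {d : ℕ} (i : Fin d) (x : CK d) :
    CK.dilation d (CK.graft i x) = (2 : ℝ) • CK.graft i (CK.dilation d x) := by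
  have : (CK.dilation d).toLinearMap ∘ₗ CK.graft i =
      (2 : ℝ) • CK.graft i ∘ₗ (CK.dilation d).toLinearMap := by
    refine (CK.basis d).ext fun ζ => ?_
    simp only [CK.basis_apply, LinearMap.comp_apply, CK.graft_of, AlgHom.toLinearMap_apply,
      CK.dilation_of, LinearMap.smul_apply, map_smul, Forest.size_singleton, Tree.size_node,
      smul_smul, pow_succ']
  exact LinearMap.congr_fun this x

/-- Homogeneity of `Δ⋆`, phrased as an identity of algebra homomorphisms so that induction over
grafting applies. -/
theorem CK.coprod_dilation {d : ℕ} (x : CK d) :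
    CK.coprod d (CK.dilation d x) = TensorProduct.map (CK.dilation d).toLinearMap
      (CK.dilation d).toLinearMap (CK.coprod d x) := by
  have key : (CK.coprodHom d).comp (CK.dilation d) =
      (Algebra.TensorProduct.map (CK.dilation d) (CK.dilation d)).comp (CK.coprodHom d) := by
    have e1 : ∀ y, ((CK.coprodHom d).comp (CK.dilation d)) y =
        CK.coprod d (CK.dilation d y) := fun y => by
      rw [← CK.coprodHom_toLinearMap]; rfl
    have e2 : ∀ y, ((Algebra.TensorProduct.map (CK.dilation d) (CK.dilation d)).comp
        (CK.coprodHom d)) y = TensorProduct.map (CK.dilation d).toLinearMap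
      (CK.dilation d).toLinearMap (CK.coprod d y) := fun y => by
      rw [← CK.coprodHom_toLinearMap]; rfl
    refine CK.algHom_ext_graft fun i ζ ih => ?_
    rw [e1, e2] at ih ⊢
    have h1 : ∀ z : CK d ⊗[ℝ] CK d, TensorProduct.map (CK.dilation d).toLinearMap
        (CK.dilation d).toLinearMap ((CK.graft i).lTensor (CK d) z) =
        (2 : ℝ) • (CK.graft i).lTensor (CK d) (TensorProduct.map (CK.dilation d).toLinearMap
          (CK.dilation d).toLinearMap z) := by
      intro z
      induction z with
      | zero => simp
      | add x y hx hy => simp only [map_add, hx, hy, smul_add]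
      | tmul x y => simp [CK.dilation_graft]
    rw [CK.coprod_graft_apply, map_add, h1, ← ih, CK.dilation_graft, map_smul,
      CK.coprod_graft_apply]
    simp [CK.dilation_graft, TensorProduct.smul_tmul']
  have := congrArg (fun φ => φ x) key
  rw [← CK.coprodHom_toLinearMap d]
  exact this

/-- Dilation multiplies the coefficient at `p` by `2 ^ (|p.1| + |p.2|)` when applied after `Δ⋆` and
by `2 ^ |ζ|` when applied before; a nonzero coefficient can be cancelled. -/
theorem size_add_size_of_cutCoeff_ne_zero {d : ℕ} {ζ : Forest d} {p : Forest d × Forest d}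
    (h : cutCoeff ζ p ≠ 0) : Forest.size p.1 + Forest.size p.2 = Forest.size ζ := by
  set b := (CK.basis d).tensorProduct (CK.basis d)
  have h1 : ∀ z : CK d ⊗[ℝ] CK d, b.repr (TensorProduct.map (CK.dilation d).toLinearMap
      (CK.dilation d).toLinearMap z) p =
      (2 : ℝ) ^ (Forest.size p.1 + Forest.size p.2) * b.repr z p := by
    intro z
    have : Finsupp.lapply p ∘ₗ b.repr.toLinearMap ∘ₗ TensorProduct.map
        (CK.dilation d).toLinearMap (CK.dilation d).toLinearMap =
        (2 : ℝ) ^ (Forest.size p.1 + Forest.size p.2) •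
          (Finsupp.lapply p ∘ₗ b.repr.toLinearMap) := by
      refine b.ext fun q => ?_
      simp only [LinearMap.comp_apply, LinearMap.smul_apply, LinearEquiv.coe_coe,
        Module.Basis.repr_self, Finsupp.lapply_apply]
      have hq : TensorProduct.map (CK.dilation d).toLinearMap (CK.dilation d).toLinearMap (b q) =
          (2 : ℝ) ^ (Forest.size q.1 + Forest.size q.2) • b q := by
        simp only [b, Module.Basis.tensorProduct_apply', TensorProduct.map_tmul, CK.basis_apply,
          AlgHom.toLinearMap_apply, CK.dilation_of, TensorProduct.smul_tmul_smul, pow_add]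
      rw [hq, map_smul, Module.Basis.repr_self, Finsupp.smul_apply]
      by_cases hpq : q = p
      · rw [hpq]
      · simp [Finsupp.single_eq_of_ne' hpq]
    exact LinearMap.congr_fun this z
  have h2 := h1 (CK.coprod d (CK.of ζ))
  rw [← CK.coprod_dilation, CK.dilation_of, map_smul, map_smul, Finsupp.smul_apply] at h2
  have h3 := mul_right_cancel₀ h h2
  exact (pow_right_injective₀ (by norm_num : (0 : ℝ) < 2) (by norm_num) h3).symm

/-! ### The Grossman–Larson product -/

theorem pairing_of {d : ℕ} (x : Series d) (ζ : Forest d) : pairing x (CK.of ζ) = x ζ := by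
  rw [← CK.basis_apply, pairing, Module.Basis.constr_basis]

/-- Turns the coefficient sum into convolution of functionals, so that product laws become duals of
coproduct laws. -/
theorem glMul_apply {d : ℕ} (x y : Series d) (ζ : Forest d) :
    glMul x y ζ = tensorDual (pairing x) (pairing y) (CK.coprod d (CK.of ζ)) := by
  set b := (CK.basis d).tensorProduct (CK.basis d)
  rw [← b.linearCombination_repr (CK.coprod d (CK.of ζ)), Finsupp.linearCombination_apply,
    map_finsuppSum]
  refine Finsupp.sum_congr fun p _ => ?_
  simp [b, tensorDual, Module.Basis.tensorProduct_apply', CK.basis_apply, pairing_of]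

theorem pairing_glMul {d : ℕ} (x y : Series d) :
    pairing (glMul x y) = tensorDual (pairing x) (pairing y) ∘ₗ CK.coprod d := by
  refine (CK.basis d).ext fun ζ => ?_
  rw [CK.basis_apply, pairing_of, glMul_apply, LinearMap.comp_apply]

theorem glMul_assoc {d : ℕ} (x y z : Series d) :
    glMul (glMul x y) z = glMul x (glMul y z) := by
  funext ζ
  rw [glMul_apply, glMul_apply, pairing_glMul, pairing_glMul]
  set f := pairing x
  set g := pairing y
  set h := pairing z
  -- The triple functional `f ⊗ g ⊗ h`; both bracketings evaluate it on an iterated coproduct.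
  set D := LinearMap.mul' ℝ ℝ ∘ₗ TensorProduct.map f (tensorDual g h)
  have h1 : ∀ w : CK d ⊗[ℝ] CK d, tensorDual f (tensorDual g h ∘ₗ CK.coprod d) w =
      D ((CK.coprod d).lTensor (CK d) w) := by
    intro w
    induction w with
    | zero => simp
    | add x y hx hy => simp only [map_add, hx, hy]
    | tmul x y => simp [tensorDual, D]
  have h2 : ∀ w : CK d ⊗[ℝ] CK d, tensorDual (tensorDual f g ∘ₗ CK.coprod d) h w =
      D (TensorProduct.assoc ℝ (CK d) (CK d) (CK d) ((CK.coprod d).rTensor (CK d) w)) := by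
    intro w
    induction w with
    | zero => simp
    | add x y hx hy => simp only [map_add, hx, hy]
    | tmul x y =>
      simp only [tensorDual, LinearMap.comp_apply, LinearMap.rTensor_tmul,
        TensorProduct.map_tmul, LinearMap.mul'_apply]
      induction CK.coprod d x with
      | zero => simp
      | add x y hx hy => simp only [map_add, TensorProduct.add_tmul, add_mul, hx, hy]
      | tmul x y => simp [tensorDual, D, mul_assoc]
  rw [h1, h2, CK.coassoc]

theorem pairing_unit (d : ℕ) : pairing (unit d) = (CK.counitHom d).toLinearMap := by
  refine (CK.basis d).ext fun ζ => ?_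
  rw [CK.basis_apply, pairing_of, AlgHom.toLinearMap_apply, CK.counitHom_of]

theorem unit_glMul {d : ℕ} (x : Series d) : glMul (unit d) x = x := by
  funext ζ
  have h1 : ∀ w : CK d ⊗[ℝ] CK d, tensorDual (pairing (unit d)) (pairing x) w =
      pairing x (TensorProduct.lid ℝ (CK d)
        ((CK.counitHom d).toLinearMap.rTensor (CK d) w)) := by
    intro w
    induction w with
    | zero => simp
    | add x y hx hy => simp only [map_add, hx, hy]
    | tmul x y => simp [tensorDual, pairing_unit]
  rw [glMul_apply, h1, CK.counit_coprod, pairing_of]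

theorem glMul_unit {d : ℕ} (x : Series d) : glMul x (unit d) = x := by
  funext ζ
  have h1 : ∀ w : CK d ⊗[ℝ] CK d, tensorDual (pairing x) (pairing (unit d)) w =
      pairing x (TensorProduct.rid ℝ (CK d)
        ((CK.counitHom d).toLinearMap.lTensor (CK d) w)) := by
    intro w
    induction w with
    | zero => simp
    | add x y hx hy => simp only [map_add, hx, hy]
    | tmul x y => simp [tensorDual, pairing_unit, mul_comm]
  rw [glMul_apply, h1, CK.coprod_counit, pairing_of]

-- With this the unit laws of the product give the coefficients of the cuts with empty crown or
-- empty trunk.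
open Classical in
theorem glMul_single_single {d : ℕ} (C T ζ : Forest d) :
    glMul (Pi.single C 1) (Pi.single T 1) ζ = cutCoeff ζ (C, T) := by
  rw [glMul, Finsupp.sum, Finset.sum_eq_single (C, T)]
  · simp
  · rintro ⟨C', T'⟩ - h
    by_cases h1 : C' = C
    · have h2 : T' ≠ T := fun h2 => h (by rw [h1, h2])
      simp [Pi.single_eq_of_ne h2]
    · simp [Pi.single_eq_of_ne h1]
  · intro h
    simp [Finsupp.notMem_support_iff.1 h]

open Classical in
theorem unit_eq_single (d : ℕ) : unit d = Pi.single 0 1 := by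
  funext ζ
  simp [unit, Pi.single_apply]

open Classical in
theorem cutCoeff_zero_left {d : ℕ} (ζ T : Forest d) :
    cutCoeff ζ (0, T) = if ζ = T then 1 else 0 := by
  rw [← glMul_single_single, ← unit_eq_single, unit_glMul, Pi.single_apply]

open Classical in
theorem cutCoeff_zero_right {d : ℕ} (ζ C : Forest d) :
    cutCoeff ζ (C, 0) = if ζ = C then 1 else 0 := by
  rw [← glMul_single_single, ← unit_eq_single, glMul_unit, Pi.single_apply]

theorem Forest.size_eq_zero {d : ℕ} {ζ : Forest d} : Forest.size ζ = 0 ↔ ζ = 0 := by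
  refine ⟨fun h => ?_, fun h => h ▸ Forest.size_zero⟩
  have := Forest.card_le_size ζ
  exact Multiset.card_eq_zero.1 (by omega)

open Classical in
/-- The cuts of `ζ` for which neither the crown nor the trunk is empty. -/
noncomputable def properCuts {d : ℕ} (ζ : Forest d) : Finset (Forest d × Forest d) :=
  (cutCoeff ζ).support.filter fun p => p.1 ≠ 0 ∧ p.2 ≠ 0

/-- The part of `(x ⋆ y)_ζ` coming from the cuts with nonempty crown and trunk. -/
noncomputable def glRest {d : ℕ} (x y : Series d) (ζ : Forest d) : ℝ :=
  ∑ p ∈ properCuts ζ, cutCoeff ζ p * (x p.1 * y p.2)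

theorem size_lt_of_mem_properCuts {d : ℕ} {ζ : Forest d} {p : Forest d × Forest d}
    (h : p ∈ properCuts ζ) : Forest.size p.1 < Forest.size ζ ∧ Forest.size p.2 < Forest.size ζ ∧
      Forest.size p.1 + Forest.size p.2 = Forest.size ζ := by
  classical
  obtain ⟨h1, h2, h3⟩ := Finset.mem_filter.1 h
  have h4 := size_add_size_of_cutCoeff_ne_zero (Finsupp.mem_support_iff.1 h1)
  rw [Ne, ← Forest.size_eq_zero] at h2 h3
  omega

theorem glRest_congr {d : ℕ} {x x' y y' : Series d} {ζ : Forest d}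
    (hx : ∀ η, Forest.size η < Forest.size ζ → x η = x' η)
    (hy : ∀ η, Forest.size η < Forest.size ζ → y η = y' η) : glRest x y ζ = glRest x' y' ζ := by
  refine Finset.sum_congr rfl fun p hp => ?_
  obtain ⟨h1, h2, -⟩ := size_lt_of_mem_properCuts hp
  rw [hx _ h1, hy _ h2]

theorem glMul_zero {d : ℕ} (x y : Series d) : glMul x y 0 = x 0 * y 0 := by
  rw [glMul_apply, CK.coprod_one]
  simp [tensorDual, pairing_of]

/-- The triangular form behind all later recursions: apart from the two trivial cuts, only forests
strictly smaller than `ζ` contribute. -/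
theorem glMul_eq_add_glRest {d : ℕ} (x y : Series d) {ζ : Forest d} (hζ : ζ ≠ 0) :
    glMul x y ζ = x ζ * y 0 + x 0 * y ζ + glRest x y ζ := by
  classical
  have h1 : ((ζ, 0) : Forest d × Forest d) ∈ (cutCoeff ζ).support := by
    simp [cutCoeff_zero_right]
  have h2 : ((0, ζ) : Forest d × Forest d) ∈ (cutCoeff ζ).support := by
    simp [cutCoeff_zero_left]
  have h3 : (cutCoeff ζ).support.filter (fun p => ¬(p.1 ≠ 0 ∧ p.2 ≠ 0)) = {(ζ, 0), (0, ζ)} := by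
    ext ⟨C, T⟩
    simp only [Finset.mem_filter, Finset.mem_insert, Finset.mem_singleton, Prod.mk.injEq]
    constructor
    · rintro ⟨h4, h5⟩
      by_cases hC : C = 0
      · subst hC
        simp only [Finsupp.mem_support_iff, cutCoeff_zero_left] at h4
        right
        simpa [eq_comm] using h4
      · have hT : T = 0 := by simpa [hC] using h5
        subst hT
        simp only [Finsupp.mem_support_iff, cutCoeff_zero_right] at h4
        left
        simpa [eq_comm] using h4
    · rintro (⟨rfl, rfl⟩ | ⟨rfl, rfl⟩)
      · exact ⟨h1, by simp⟩
      · exact ⟨h2, by simp⟩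
  rw [glMul, Finsupp.sum, ← Finset.sum_filter_add_sum_filter_not _ (fun p => p.1 ≠ 0 ∧ p.2 ≠ 0),
    h3, Finset.sum_pair (by simp [hζ]), cutCoeff_zero_left, cutCoeff_zero_right]
  simp only [if_true, one_mul]
  rw [add_comm]
  rfl

theorem glMul_congr {d : ℕ} {x x' y y' : Series d} {ζ : Forest d}
    (hx : ∀ η, Forest.size η ≤ Forest.size ζ → x η = x' η)
    (hy : ∀ η, Forest.size η ≤ Forest.size ζ → y η = y' η) : glMul x y ζ = glMul x' y' ζ := by
  by_cases hζ : ζ = 0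
  · subst hζ
    rw [glMul_zero, glMul_zero, hx 0 le_rfl, hy 0 le_rfl]
  · have h0 : Forest.size (0 : Forest d) ≤ Forest.size ζ := by simp [Forest.size_zero]
    rw [glMul_eq_add_glRest _ _ hζ, glMul_eq_add_glRest _ _ hζ, hx 0 h0, hy 0 h0, hx ζ le_rfl,
      hy ζ le_rfl, glRest_congr (fun η h => hx η h.le) fun η h => hy η h.le]

end BranchedRP

namespace BranchedRP

/-! ### The group of group-like series -/

/-- A nonzero multiplicative map satisfies `x 0 * x ζ = x ζ` for some `x ζ ≠ 0`, which forces the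
value 1 at the empty forest. -/
theorem mem_groupLike_iff {d : ℕ} {x : Series d} :
    x ∈ groupLike d ↔ x 0 = 1 ∧ ∀ ζ₁ ζ₂, x (ζ₁ + ζ₂) = x ζ₁ * x ζ₂ := by
  constructor
  · rintro ⟨h0, h⟩
    have hadd : ∀ ζ₁ ζ₂, x (ζ₁ + ζ₂) = x ζ₁ * x ζ₂ := fun ζ₁ ζ₂ => congrFun h (ζ₁, ζ₂)
    obtain ⟨ζ, hζ⟩ := Function.ne_iff.1 h0
    refine ⟨mul_right_cancel₀ hζ ?_, hadd⟩
    rw [one_mul, ← hadd, zero_add]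
  · rintro ⟨h0, h⟩
    refine ⟨fun hx => ?_, funext fun p => h p.1 p.2⟩
    rw [hx] at h0
    exact zero_ne_one h0

/-- The type of group-like formal series. -/
def GroupLike (d : ℕ) : Type := groupLike d

namespace GroupLike

variable {d : ℕ}

theorem ext {x y : GroupLike d} (h : ∀ ζ, x.1 ζ = y.1 ζ) : x = y := Subtype.ext (funext h)

theorem apply_zero (x : GroupLike d) : x.1 0 = 1 := (mem_groupLike_iff.1 x.2).1

theorem apply_add (x : GroupLike d) (ζ₁ ζ₂ : Forest d) : x.1 (ζ₁ + ζ₂) = x.1 ζ₁ * x.1 ζ₂ :=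
  (mem_groupLike_iff.1 x.2).2 ζ₁ ζ₂

theorem apply_cons (x : GroupLike d) (τ : Tree d) (ζ : Forest d) :
    x.1 (τ ::ₘ ζ) = x.1 {τ} * x.1 ζ := by
  rw [← Multiset.singleton_add, x.apply_add]

/-- The group-like series with prescribed values on trees. -/
noncomputable def ofTrees (f : Tree d → ℝ) : GroupLike d :=
  ⟨fun ζ => (ζ.map f).prod, mem_groupLike_iff.2 ⟨by simp, by simp⟩⟩

theorem ofTrees_singleton (f : Tree d → ℝ) (τ : Tree d) : (ofTrees f).1 {τ} = f τ :=
  Multiset.prod_singleton (f τ)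

theorem eq_of_trees {x y : GroupLike d} {ζ : Forest d} (h : ∀ τ ∈ ζ, x.1 {τ} = y.1 {τ}) :
    x.1 ζ = y.1 ζ := by
  induction ζ using Multiset.induction_on with
  | empty => rw [x.apply_zero, y.apply_zero]
  | cons τ ζ ih =>
    rw [x.apply_cons, y.apply_cons, h τ (Multiset.mem_cons_self τ ζ),
      ih fun σ hσ => h σ (Multiset.mem_cons_of_mem hσ)]

theorem eq_of_trees_le {x y : GroupLike d} {n : ℕ}
    (h : ∀ τ : Tree d, τ.size ≤ n → x.1 {τ} = y.1 {τ}) {ζ : Forest d} (hζ : Forest.size ζ ≤ n) :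
    x.1 ζ = y.1 ζ :=
  eq_of_trees fun τ hτ => h τ ((Forest.size_le_of_mem hτ).trans hζ)

/-- The algebra homomorphism `⟨·, x⟩`. -/
noncomputable def hom (x : GroupLike d) : CK d →ₐ[ℝ] ℝ :=
  CK.lift x.1 x.apply_zero x.apply_add

theorem hom_toLinearMap (x : GroupLike d) : x.hom.toLinearMap = pairing x.1 := by
  refine (CK.basis d).ext fun ζ => ?_
  rw [CK.basis_apply, pairing_of, AlgHom.toLinearMap_apply, hom, CK.lift_of]

/-- The convolution of two characters is a composite of algebra homomorphisms, because `Δ⋆` is one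
and `ℝ` is commutative. -/
theorem glMul_mem (x y : GroupLike d) : glMul x.1 y.1 ∈ groupLike d := by
  set φ : CK d →ₐ[ℝ] ℝ := (Algebra.TensorProduct.lmul' ℝ (S := ℝ)).comp
    ((Algebra.TensorProduct.map x.hom y.hom).comp (CK.coprodHom d))
  have h : ∀ ζ, glMul x.1 y.1 ζ = φ (CK.of ζ) := fun ζ => by
    rw [glMul_apply, ← hom_toLinearMap, ← hom_toLinearMap, ← CK.coprodHom_apply]
    rfl
  refine mem_groupLike_iff.2 ⟨?_, fun ζ₁ ζ₂ => ?_⟩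
  · rw [h, CK.of_zero, map_one]
  · rw [h, h, h, CK.of_add, map_mul]

noncomputable instance : Mul (GroupLike d) := ⟨fun x y => ⟨glMul x.1 y.1, glMul_mem x y⟩⟩

noncomputable instance : One (GroupLike d) :=
  ⟨⟨unit d, mem_groupLike_iff.2 ⟨by simp [unit], fun ζ₁ ζ₂ => by
    rw [← CK.counitHom_of, ← CK.counitHom_of, ← CK.counitHom_of, CK.of_add, map_mul]⟩⟩⟩

theorem coe_mul (x y : GroupLike d) : (x * y).1 = glMul x.1 y.1 := rfl

theorem coe_one : (1 : GroupLike d).1 = unit d := rfl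

theorem one_apply_singleton (τ : Tree d) : (1 : GroupLike d).1 {τ} = 0 := by
  simp [coe_one, unit]

theorem mul_apply_singleton (x y : GroupLike d) (τ : Tree d) :
    (x * y).1 {τ} = x.1 {τ} + y.1 {τ} + glRest x.1 y.1 {τ} := by
  rw [coe_mul, glMul_eq_add_glRest _ _ (Multiset.singleton_ne_zero τ), x.apply_zero, y.apply_zero,
    mul_one, one_mul]

theorem mul_congr {x x' y y' : GroupLike d} {n : ℕ}
    (hx : ∀ η, Forest.size η ≤ n → x.1 η = x'.1 η) (hy : ∀ η, Forest.size η ≤ n → y.1 η = y'.1 η)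
    {ζ : Forest d} (hζ : Forest.size ζ ≤ n) : (x * y).1 ζ = (x' * y').1 ζ :=
  glMul_congr (fun η h => hx η (h.trans hζ)) fun η h => hy η (h.trans hζ)

/-- A product changes additively if its factors are changed on the trees of highest order only. -/
theorem mul_apply_sub {x x' y y' : GroupLike d} {n : ℕ}
    (hx : ∀ η, Forest.size η ≤ n → x.1 η = x'.1 η) (hy : ∀ η, Forest.size η ≤ n → y.1 η = y'.1 η)
    {τ : Tree d} (hτ : τ.size ≤ n + 1) :
    (x * y).1 {τ} - (x' * y').1 {τ} = (x.1 {τ} - x'.1 {τ}) + (y.1 {τ} - y'.1 {τ}) := by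
  rw [mul_apply_singleton, mul_apply_singleton, glRest_congr (x' := x'.1) (y' := y'.1)]
  · ring
  · intro η h
    rw [Forest.size_singleton] at h
    exact hx η (by omega)
  · intro η h
    rw [Forest.size_singleton] at h
    exact hy η (by omega)

/-! ### Recursive construction by order, and inverses -/

/-- Construction of families of group-like series level by level. -/
theorem exists_of_step {α : Type*} (P : ℕ → (α → GroupLike d) → Prop) (N : ℕ)
    (hP : ∀ n X X', (∀ a ζ, Forest.size ζ ≤ n → (X a).1 ζ = (X' a).1 ζ) → P n X → P n X')
    (hstep : ∀ n, N ≤ n → ∀ X, P n X →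
      ∃ X', P (n + 1) X' ∧ ∀ a ζ, Forest.size ζ ≤ n → (X' a).1 ζ = (X a).1 ζ)
    (X₀ : α → GroupLike d) (h₀ : P N X₀) :
    ∃ X, (∀ n, N ≤ n → P n X) ∧ ∀ a ζ, Forest.size ζ ≤ N → (X a).1 ζ = (X₀ a).1 ζ := by
  choose! F hF hF' using hstep
  -- Stage `k` satisfies `P (N + k)`, and later stages no longer change orders up to `N + k`.
  let Y : ℕ → α → GroupLike d := fun k => Nat.rec X₀ (fun k X => F (N + k) X) k
  have hY : ∀ k, P (N + k) (Y k) := by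
    intro k
    induction k with
    | zero => exact h₀
    | succ k ih => exact hF (N + k) (Nat.le_add_right _ _) _ ih
  have hY' : ∀ k l, k ≤ l → ∀ a ζ, Forest.size ζ ≤ N + k → (Y l a).1 ζ = (Y k a).1 ζ := by
    intro k l hkl a ζ hζ
    induction l, hkl using Nat.le_induction with
    | base => rfl
    | succ l hl ih =>
      rw [← ih]
      exact hF' (N + l) (Nat.le_add_right _ _) _ (hY l) a ζ (by omega)
  -- A tree is read off at the stage indexed by its own size, at which its value is already final.
  let X : α → GroupLike d := fun a => ofTrees fun τ => (Y τ.size a).1 {τ}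
  have hX : ∀ k a ζ, Forest.size ζ ≤ N + k → (X a).1 ζ = (Y k a).1 ζ := by
    intro k a ζ hζ
    refine eq_of_trees_le (n := N + k) (fun τ hτ => ?_) hζ
    rw [ofTrees_singleton]
    rcases le_total k τ.size with h | h
    · exact hY' _ _ h a _ (by rwa [Forest.size_singleton])
    · exact (hY' _ _ h a _ (by rw [Forest.size_singleton]; omega)).symm
  refine ⟨X, fun n hn => ?_, fun a ζ hζ => hX 0 a ζ hζ⟩
  obtain ⟨k, rfl⟩ := Nat.exists_eq_add_of_le hn
  exact hP _ (Y k) _ (fun a ζ hζ => (hX k a ζ hζ).symm) (hY k)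

open Classical in
/-- Change of a group-like series on the trees of a given order. -/
noncomputable def shift (x : GroupLike d) (n : ℕ) (f : Tree d → ℝ) : GroupLike d :=
  ofTrees fun τ => if τ.size = n then x.1 {τ} + f τ else x.1 {τ}

theorem shift_singleton (x : GroupLike d) {n : ℕ} (f : Tree d → ℝ) {τ : Tree d}
    (hτ : τ.size = n) : (x.shift n f).1 {τ} = x.1 {τ} + f τ := by
  rw [shift, ofTrees_singleton, if_pos hτ]

theorem shift_apply (x : GroupLike d) {n : ℕ} (f : Tree d → ℝ) {ζ : Forest d}
    (hζ : Forest.size ζ < n) : (x.shift n f).1 ζ = x.1 ζ := by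
  refine eq_of_trees fun τ hτ => ?_
  have := Forest.size_le_of_mem hτ
  rw [shift, ofTrees_singleton, if_neg (by omega)]

/-- A right inverse is built order by order: given the lower orders, the value of `x * y` at a new
tree is the value of `y` there plus a known number. -/
theorem exists_mul_eq_one (x : GroupLike d) : ∃ y, x * y = 1 := by
  obtain ⟨X, hX, -⟩ := exists_of_step (α := Unit)
    (fun n X => ∀ τ : Tree d, τ.size ≤ n → (x * X ()).1 {τ} = 0) 0
    (fun n X X' h hX τ hτ => by
      rw [← hX τ hτ]
      exact mul_congr (n := n) (fun _ _ => rfl) (fun η hη => (h () η hη).symm)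
        (by rwa [Forest.size_singleton]))
    (fun n _ X hX => by
      refine ⟨fun u => (X u).shift (n + 1) fun τ => -(x * X ()).1 {τ}, fun τ hτ => ?_,
        fun u ζ hζ => shift_apply _ _ (by omega)⟩
      have h := mul_apply_sub (x := x) (x' := x)
        (y := (X ()).shift (n + 1) fun τ => -(x * X ()).1 {τ}) (y' := X ()) (n := n)
        (fun _ _ => rfl) (fun η hη => shift_apply _ _ (by omega)) hτ
      rcases hτ.lt_or_eq with h1 | h1
      · rw [shift_apply _ _ (by rwa [Forest.size_singleton])] at h
        have := hX τ (by omega)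
        linarith
      · rw [shift_singleton _ _ h1] at h
        linarith)
    -- There is nothing to check at order 0, since every tree has a vertex.
    (fun _ => 1) (fun τ hτ => by have := τ.one_le_size; omega)
  refine ⟨X (), ext fun ζ => eq_of_trees fun τ _ => ?_⟩
  rw [hX τ.size (Nat.zero_le _) τ le_rfl, one_apply_singleton]

noncomputable instance : Inv (GroupLike d) := ⟨fun x => x.exists_mul_eq_one.choose⟩

noncomputable instance : Group (GroupLike d) :=
  Group.ofRightAxioms (fun x y z => Subtype.ext (glMul_assoc x.1 y.1 z.1))
    (fun x => Subtype.ext (glMul_unit x.1)) fun x => x.exists_mul_eq_one.choose_spec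

end GroupLike

/-- The chosen inverse is not known to be group-like; uniqueness of inverses in the monoid of all
series identifies it with the group inverse. -/
theorem glInv_eq {d : ℕ} (x : GroupLike d) : glInv x.1 = x⁻¹.1 := by
  have h1 : glMul x.1 x⁻¹.1 = unit d := congrArg Subtype.val (mul_inv_cancel x)
  have h2 : glMul x⁻¹.1 x.1 = unit d := congrArg Subtype.val (inv_mul_cancel x)
  have h : ∃ y, glMul x.1 y = unit d ∧ glMul y x.1 = unit d := ⟨_, h1, h2⟩
  rw [glInv, dif_pos h]
  calc h.choose = glMul (glMul x⁻¹.1 x.1) h.choose := by rw [h2, unit_glMul]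
    _ = x⁻¹.1 := by rw [glMul_assoc, h.choose_spec.1, glMul_unit]

/-! ### Truncation -/

theorem incl_apply {d n : ℕ} (x : TruncSeries d n) {ζ : Forest d} (h : Forest.size ζ ≤ n) :
    incl x ζ = x ⟨ζ, h⟩ := dif_pos h

theorem incl_apply_of_lt {d n : ℕ} (x : TruncSeries d n) {ζ : Forest d}
    (h : n < Forest.size ζ) : incl x ζ = 0 := dif_neg (by omega)

theorem proj_incl {d n : ℕ} (x : TruncSeries d n) : proj n (incl x) = x :=
  funext fun ζ => incl_apply x ζ.2

theorem incl_proj_apply {d n : ℕ} (x : Series d) {ζ : Forest d} (h : Forest.size ζ ≤ n) :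
    incl (proj n x) ζ = x ζ := incl_apply _ h

/-- Truncation is a homomorphism; since every truncated series is a projection, the monoid laws
descend. -/
theorem proj_glMul {d n : ℕ} (x y : Series d) :
    proj n (glMul x y) = glMulTrunc (proj n x) (proj n y) :=
  funext fun ζ => glMul_congr (fun _ h => (incl_proj_apply x (h.trans ζ.2)).symm)
    fun _ h => (incl_proj_apply y (h.trans ζ.2)).symm

theorem glMulTrunc_assoc {d n : ℕ} (x y z : TruncSeries d n) :
    glMulTrunc (glMulTrunc x y) z = glMulTrunc x (glMulTrunc y z) := by
  rw [← proj_incl x, ← proj_incl y, ← proj_incl z]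
  simp only [← proj_glMul, glMul_assoc]

theorem unitTrunc_glMulTrunc {d n : ℕ} (x : TruncSeries d n) :
    glMulTrunc (unitTrunc d n) x = x := by
  rw [← proj_incl x, unitTrunc, ← proj_glMul, unit_glMul]

theorem glMulTrunc_unitTrunc {d n : ℕ} (x : TruncSeries d n) :
    glMulTrunc x (unitTrunc d n) = x := by
  rw [← proj_incl x, unitTrunc, ← proj_glMul, glMul_unit]

theorem glInvTrunc_proj {d n : ℕ} (x : GroupLike d) :
    glInvTrunc (proj n x.1) = proj n x⁻¹.1 := by
  have h1 : glMulTrunc (proj n x.1) (proj n x⁻¹.1) = unitTrunc d n := by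
    rw [← proj_glMul, ← GroupLike.coe_mul, mul_inv_cancel]; rfl
  have h2 : glMulTrunc (proj n x⁻¹.1) (proj n x.1) = unitTrunc d n := by
    rw [← proj_glMul, ← GroupLike.coe_mul, inv_mul_cancel]; rfl
  have h : ∃ y, glMulTrunc (proj n x.1) y = unitTrunc d n ∧
    glMulTrunc y (proj n x.1) = unitTrunc d n := ⟨_, h1, h2⟩
  rw [glInvTrunc, dif_pos h]
  calc h.choose = glMulTrunc (glMulTrunc (proj n x⁻¹.1) (proj n x.1)) h.choose := by
        rw [h2, unitTrunc_glMulTrunc]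
    _ = proj n x⁻¹.1 := by rw [glMulTrunc_assoc, h.choose_spec.1, glMulTrunc_unitTrunc]

theorem exists_groupLike_of_mul {d n : ℕ} {g : TruncSeries d n} (h0 : g (ForestLE.empty d n) = 1)
    (hadd : ∀ (ζ₁ ζ₂ : ForestLE d n) (h : Forest.size (ζ₁.1 + ζ₂.1) ≤ n),
      g ⟨ζ₁.1 + ζ₂.1, h⟩ = g ζ₁ * g ζ₂) : ∃ x : GroupLike d, proj n x.1 = g := by
  -- Trees beyond order `n` receive the value 0; any other values would do.
  refine ⟨GroupLike.ofTrees fun τ => incl g {τ}, funext fun ⟨ζ, hζ⟩ => ?_⟩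
  change (GroupLike.ofTrees _).1 ζ = _
  induction ζ using Multiset.induction_on with
  | empty => rw [GroupLike.apply_zero]; exact h0.symm
  | cons τ ζ ih =>
    have h : Forest.size ({τ} + ζ) ≤ n := by rwa [Multiset.singleton_add]
    have h' := h
    rw [Forest.size_add] at h'
    have h1 := hadd ⟨{τ}, by omega⟩ ⟨ζ, by omega⟩ h
    simp only [Multiset.singleton_add] at h1
    rw [GroupLike.apply_cons, ih (by omega), h1, GroupLike.ofTrees_singleton, incl_apply]

theorem mem_groupLikeTrunc_iff {d n : ℕ} {g : TruncSeries d n} :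
    g ∈ groupLikeTrunc d n ↔ ∃ x : GroupLike d, proj n x.1 = g := by
  constructor
  · rintro ⟨h0, h⟩
    have hadd : ∀ (ζ₁ ζ₂ : ForestLE d n) (h : Forest.size (ζ₁.1 + ζ₂.1) ≤ n),
        g ⟨ζ₁.1 + ζ₂.1, h⟩ = g ζ₁ * g ζ₂ := fun ζ₁ ζ₂ h' => by
      have h1 := congrFun h (ζ₁.1, ζ₂.1)
      rw [forestCoprod, incl_apply g h', projTensor, if_pos (by rwa [← Forest.size_add]),
        tensorSeries, incl_apply g ζ₁.2, incl_apply g ζ₂.2] at h1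
      exact h1
    refine exists_groupLike_of_mul ?_ hadd
    obtain ⟨ζ, hζ⟩ := Function.ne_iff.1 h0
    have h1 := hadd (ForestLE.empty d n) ζ (by simpa [ForestLE.empty] using ζ.2)
    simp only [ForestLE.empty, zero_add] at h1
    refine mul_right_cancel₀ hζ ?_
    rw [one_mul]
    exact h1.symm
  · rintro ⟨x, rfl⟩
    refine ⟨fun h => ?_, funext fun p => ?_⟩
    · have := congrFun h (ForestLE.empty d n)
      exact one_ne_zero (x.apply_zero.symm.trans this)
    · rw [forestCoprod, projTensor]
      split_ifs with h
      · rw [tensorSeries, incl_proj_apply _ (by rwa [Forest.size_add]), x.apply_add,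
          incl_proj_apply _ (by omega), incl_proj_apply _ (by omega)]
      · exact incl_apply_of_lt _ (by rw [Forest.size_add]; omega)

end BranchedRP

namespace BranchedRP

/-! ### Homogeneous bounds -/

/-- The coefficients of `x` up to order `n` satisfy `|x_ζ| ≤ K r^{|ζ|}`. -/
def HomBound {d : ℕ} (n : ℕ) (K r : ℝ) (x : Series d) : Prop :=
  ∀ ζ, Forest.size ζ ≤ n → |x ζ| ≤ K * r ^ Forest.size ζ

theorem HomBound.mono {d n m : ℕ} {K L r : ℝ} {x : Series d} (h : HomBound m K r x) (hnm : n ≤ m)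
    (hr : 0 ≤ r) (hKL : K ≤ L) : HomBound n L r x := fun ζ hζ =>
  (h ζ (hζ.trans hnm)).trans (mul_le_mul_of_nonneg_right hKL (pow_nonneg hr _))

theorem HomBound.mono_scale {d n : ℕ} {K r r' : ℝ} {x : Series d} (h : HomBound n K r x)
    (hK : 0 ≤ K) (hr : 0 ≤ r) (hrr' : r ≤ r') : HomBound n K r' x := fun ζ hζ =>
  (h ζ hζ).trans (mul_le_mul_of_nonneg_left (pow_le_pow_left₀ hr hrr' _) hK)

theorem homBound_unit (d n : ℕ) {r : ℝ} (hr : 0 ≤ r) : HomBound n 1 r (unit d) := by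
  intro ζ _
  by_cases h : ζ = 0
  · simp [h, unit, Forest.size_zero]
  · simpa [h, unit] using pow_nonneg hr _

theorem HomBound.sub {d n : ℕ} {K L r : ℝ} {x y : Series d} (hx : HomBound n K r x)
    (hy : HomBound n L r y) : HomBound n (K + L) r (x - y) := by
  intro ζ hζ
  rw [Pi.sub_apply, add_mul]
  exact (abs_sub _ _).trans (add_le_add (hx ζ hζ) (hy ζ hζ))

/-- A bound for the total mass of the cuts of forests of order at most `n`. -/
noncomputable def cutMass (d n : ℕ) : ℝ :=
  ∑ ζ : ForestLE d n, ∑ p ∈ properCuts ζ.1, |cutCoeff ζ.1 p|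

theorem cutMass_nonneg (d n : ℕ) : 0 ≤ cutMass d n :=
  Finset.sum_nonneg fun _ _ => Finset.sum_nonneg fun _ _ => abs_nonneg _

theorem sum_abs_cutCoeff_le {d n : ℕ} {ζ : Forest d} (hζ : Forest.size ζ ≤ n) :
    ∑ p ∈ properCuts ζ, |cutCoeff ζ p| ≤ cutMass d n := by
  have key : ∀ f : ForestLE d n → ℝ, (∀ η, 0 ≤ f η) → ∀ η, f η ≤ ∑ η, f η := fun f hf η =>
    Finset.single_le_sum (fun η _ => hf η) (Finset.mem_univ η)
  exact key (fun η => ∑ p ∈ properCuts η.1, |cutCoeff η.1 p|)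
    (fun _ => Finset.sum_nonneg fun _ _ => abs_nonneg _) ⟨ζ, hζ⟩

/-- Crown and trunk sizes add up to `|ζ|`, so the powers of `r` multiply correctly. Bounds up to
order `n` already control order `n + 1`, since proper cuts have smaller pieces. -/
theorem abs_glRest_le {d n : ℕ} {K L r : ℝ} {x y : Series d} (hK : 0 ≤ K) (hL : 0 ≤ L)
    (hr : 0 ≤ r) (hx : HomBound n K r x) (hy : HomBound n L r y) {ζ : Forest d}
    (hζ : Forest.size ζ ≤ n + 1) :
    |glRest x y ζ| ≤ cutMass d (n + 1) * (K * L) * r ^ Forest.size ζ := by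
  calc |glRest x y ζ| ≤ ∑ p ∈ properCuts ζ, |cutCoeff ζ p * (x p.1 * y p.2)| :=
        Finset.abs_sum_le_sum_abs _ _
    _ ≤ ∑ p ∈ properCuts ζ, |cutCoeff ζ p| * (K * L * r ^ Forest.size ζ) := by
        refine Finset.sum_le_sum fun p hp => ?_
        obtain ⟨h1, h2, h3⟩ := size_lt_of_mem_properCuts hp
        have h4 := hx p.1 (by omega)
        have h5 := hy p.2 (by omega)
        have h6 := mul_le_mul h4 h5 (abs_nonneg _) (mul_nonneg hK (pow_nonneg hr _))
        have h7 : K * L * r ^ Forest.size ζ =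
            K * r ^ Forest.size p.1 * (L * r ^ Forest.size p.2) := by
          rw [← h3, pow_add]; ring
        rw [abs_mul, abs_mul, h7]
        exact mul_le_mul_of_nonneg_left h6 (abs_nonneg _)
    _ = (∑ p ∈ properCuts ζ, |cutCoeff ζ p|) * (K * L * r ^ Forest.size ζ) := by
        rw [Finset.sum_mul]
    _ ≤ cutMass d (n + 1) * (K * L * r ^ Forest.size ζ) :=
        mul_le_mul_of_nonneg_right (sum_abs_cutCoeff_le hζ)
          (mul_nonneg (mul_nonneg hK hL) (pow_nonneg hr _))
    _ = _ := by ring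

/-- The 2 in the constant accounts for the two trivial cuts. -/
theorem HomBound.glMul {d n : ℕ} {K L r : ℝ} {x y : Series d} (hK : 0 ≤ K) (hL : 0 ≤ L)
    (hr : 0 ≤ r) (hx : HomBound n K r x) (hy : HomBound n L r y) :
    HomBound n ((2 + cutMass d (n + 1)) * (K * L)) r (glMul x y) := by
  intro ζ hζ
  have hM := cutMass_nonneg d (n + 1)
  have hx0 : |x 0| ≤ K := by simpa [Forest.size_zero] using hx 0 (by simp [Forest.size_zero])
  have hy0 : |y 0| ≤ L := by simpa [Forest.size_zero] using hy 0 (by simp [Forest.size_zero])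
  by_cases h : ζ = 0
  · subst h
    rw [glMul_zero, abs_mul, Forest.size_zero, pow_zero, mul_one]
    have h1 := mul_le_mul hx0 hy0 (abs_nonneg _) hK
    have h2 : 0 ≤ K * L := by positivity
    nlinarith [mul_nonneg hM h2]
  · rw [glMul_eq_add_glRest _ _ h]
    have h1 := abs_glRest_le hK hL hr hx hy (hζ.trans n.le_succ)
    have h2 : |x ζ * y 0| ≤ K * L * r ^ Forest.size ζ := by
      rw [abs_mul, mul_right_comm]
      exact mul_le_mul (hx ζ hζ) hy0 (abs_nonneg _) (by positivity)
    have h3 : |x 0 * y ζ| ≤ K * L * r ^ Forest.size ζ := by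
      rw [abs_mul, mul_assoc]
      exact mul_le_mul hx0 (hy ζ hζ) (abs_nonneg _) hK
    have h4 := abs_add_three (x ζ * y 0) (x 0 * y ζ) (glRest x y ζ)
    linarith

namespace GroupLike

variable {d : ℕ}

/-- A forest of size at most `n` has at most `n` trees, and `1 ≤ K` allows raising the power of `K`
to `n`. -/
theorem homBound_of_trees (x : GroupLike d) {n : ℕ} {K r : ℝ} (hK : 1 ≤ K) (hr : 0 ≤ r)
    (h : ∀ τ : Tree d, τ.size ≤ n → |x.1 {τ}| ≤ K * r ^ τ.size) : HomBound n (K ^ n) r x.1 := by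
  have key : ∀ ζ : Forest d, Forest.size ζ ≤ n → |x.1 ζ| ≤ K ^ ζ.card * r ^ Forest.size ζ := by
    intro ζ hζ
    induction ζ using Multiset.induction_on with
    | empty => simp [x.apply_zero, Forest.size_zero]
    | cons τ ζ ih =>
      have h1 : Forest.size (τ ::ₘ ζ) = τ.size + Forest.size ζ := by
        rw [← Multiset.singleton_add, Forest.size_add, Forest.size_singleton]
      rw [x.apply_cons, abs_mul, h1, Multiset.card_cons, pow_succ', pow_add, mul_mul_mul_comm]
      exact mul_le_mul (h τ (by omega)) (ih (by omega)) (abs_nonneg _) (by positivity)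
  intro ζ hζ
  refine (key ζ hζ).trans (mul_le_mul_of_nonneg_right ?_ (pow_nonneg hr _))
  exact pow_le_pow_right₀ hK ((Forest.card_le_size ζ).trans hζ)

/-- Evaluating `x * x⁻¹ = 1` at a tree gives `x⁻¹` there as minus `x` minus a remainder of lower
order. The constant does not depend on `r`. -/
theorem exists_homBound_inv (d n : ℕ) {K : ℝ} (hK : 0 ≤ K) : ∃ L, 0 ≤ L ∧
    ∀ (x : GroupLike d) (r : ℝ), 0 ≤ r → HomBound n K r x.1 → HomBound n L r x⁻¹.1 := by
  have key : ∀ m, m ≤ n → ∃ L, 0 ≤ L ∧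
      ∀ (x : GroupLike d) (r : ℝ), 0 ≤ r → HomBound n K r x.1 → HomBound m L r x⁻¹.1 := by
    intro m hm
    induction m with
    | zero =>
      refine ⟨1, zero_le_one, fun x r _ _ ζ hζ => ?_⟩
      rw [Forest.size_eq_zero.1 (Nat.le_zero.1 hζ), apply_zero]
      simp [Forest.size_zero]
    | succ m ih =>
      obtain ⟨L, hL, h⟩ := ih (by omega)
      have hM := cutMass_nonneg d (m + 1)
      set L' := max 1 (max L (K + cutMass d (m + 1) * (K * L)))
      have hL' : 1 ≤ L' := le_max_left _ _
      refine ⟨L' ^ (m + 1), by positivity, fun x r hr hx => homBound_of_trees _ hL' hr ?_⟩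
      intro τ hτ
      have h1 := mul_apply_singleton x x⁻¹ τ
      rw [mul_inv_cancel, one_apply_singleton] at h1
      have h2 := abs_glRest_le hK hL hr (hx.mono (by omega : m ≤ n) hr le_rfl) (h x r hr hx)
        (ζ := {τ}) (by rwa [Forest.size_singleton])
      have h3 := hx {τ} (by rw [Forest.size_singleton]; omega)
      rw [Forest.size_singleton] at h2 h3
      have h4 : x⁻¹.1 {τ} = -(x.1 {τ} + glRest x.1 x⁻¹.1 {τ}) := by linarith
      rw [h4, abs_neg]
      calc |x.1 {τ} + glRest x.1 x⁻¹.1 {τ}|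
          ≤ (K + cutMass d (m + 1) * (K * L)) * r ^ τ.size := by
            rw [add_mul]
            exact (abs_add_le _ _).trans (add_le_add h3 h2)
        _ ≤ L' * r ^ τ.size := by
            refine mul_le_mul_of_nonneg_right ?_ (pow_nonneg hr _)
            exact (le_max_right _ _).trans (le_max_right _ _)
  exact key n le_rfl

end GroupLike

/-! ### The homogeneous norm -/

/-- The powers `u^{⋆ k}`. -/
noncomputable def glPow {d : ℕ} (u : Series d) : ℕ → Series d
  | 0 => unit d
  | k + 1 => glMul (glPow u k) u

theorem proj_glPow {d n : ℕ} (u : Series d) (k : ℕ) :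
    proj n (glPow u k) = glPowTrunc (proj n u) k := by
  induction k with
  | zero => rfl
  | succ k ih => rw [glPow, proj_glMul, ih]; rfl

theorem glLogTrunc_proj_apply {d n : ℕ} (x : Series d) (ζ : ForestLE d n) :
    glLogTrunc (proj n x) ζ =
      ∑ k ∈ Finset.Icc 1 n, ((-1 : ℝ) ^ (k + 1) / k) * glPow (x - unit d) k ζ.1 := by
  have h : proj n x - unitTrunc d n = proj n (x - unit d) := rfl
  rw [glLogTrunc, Finset.sum_apply]
  refine Finset.sum_congr rfl fun k _ => ?_
  rw [h, ← proj_glPow]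
  rfl

theorem exists_homBound_glPow (d n : ℕ) {K : ℝ} (hK : 0 ≤ K) (k : ℕ) : ∃ L, 0 ≤ L ∧
    ∀ (u : Series d) (r : ℝ), 0 ≤ r → HomBound n K r u → HomBound n L r (glPow u k) := by
  induction k with
  | zero => exact ⟨1, zero_le_one, fun u r hr _ => homBound_unit d n hr⟩
  | succ k ih =>
    obtain ⟨L, hL, h⟩ := ih
    have hM := cutMass_nonneg d (n + 1)
    exact ⟨_, by positivity, fun u r hr hu => HomBound.glMul hL hK hr (h u r hr hu) hu⟩

theorem glPow_succ_zero {d : ℕ} {u : Series d} (hu : u 0 = 0) (k : ℕ) :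
    glPow u (k + 1) 0 = 0 := by
  rw [glPow, glMul_zero, hu, mul_zero]

/-- When `u` vanishes at the empty forest, so do its positive powers. In a power with `k ≥ 2` both
trivial cuts therefore vanish, and order `n` of `u` controls order `n + 1` of the power. -/
theorem exists_homBound_glPow_add_two (d n : ℕ) {K : ℝ} (hK : 0 ≤ K) (k : ℕ) (hk : 2 ≤ k) :
    ∃ L, 0 ≤ L ∧ ∀ (u : Series d) (r : ℝ), 0 ≤ r → u 0 = 0 → HomBound n K r u →
      HomBound (n + 1) L r (glPow u k) := by
  obtain ⟨k, rfl⟩ := Nat.exists_eq_add_of_le' hk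
  obtain ⟨L, hL, h⟩ := exists_homBound_glPow d n hK (k + 1)
  have hM := cutMass_nonneg d (n + 1)
  refine ⟨cutMass d (n + 1) * (L * K), by positivity, fun u r hr hu0 hu ζ hζ => ?_⟩
  by_cases h0 : ζ = 0
  · subst h0
    rw [glPow_succ_zero hu0, abs_zero]
    positivity
  · rw [show k + 2 = (k + 1) + 1 from rfl, glPow, glMul_eq_add_glRest _ _ h0, hu0,
      glPow_succ_zero hu0, mul_zero, zero_mul, zero_add, zero_add]
    exact abs_glRest_le hL hK hr (h u r hr hu) hu hζ

theorem abs_neg_one_pow_div_le (k : ℕ) : |(-1 : ℝ) ^ (k + 1) / k| ≤ 1 := by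
  rw [abs_div, abs_pow, abs_neg, abs_one, one_pow, Nat.abs_cast]
  rw [one_div]
  exact Nat.cast_inv_le_one k

/-- Each logarithm coefficient is bounded by `C * r ^ |τ|`, and the root of order `|τ|` is linear in
`r`. -/
theorem exists_hNorm_le (d n : ℕ) {K : ℝ} (hK : 0 ≤ K) : ∃ L, 0 ≤ L ∧
    ∀ (x : Series d) (r : ℝ), 0 ≤ r → HomBound n K r x → hNorm (proj n x) ≤ L * r := by
  choose L hL h using fun k => exists_homBound_glPow d n (K := K + 1) (by positivity) k
  set C := ∑ k ∈ Finset.Icc 1 n, L k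
  have hC : 0 ≤ C := Finset.sum_nonneg fun k _ => hL k
  refine ⟨∑ τ : TreeLE d n, C ^ (1 / (τ.1.size : ℝ)),
    Finset.sum_nonneg fun τ _ => Real.rpow_nonneg hC _, fun x r hr hx => ?_⟩
  rw [hNorm, Finset.sum_mul]
  refine Finset.sum_le_sum fun τ _ => ?_
  have hτ : (τ.1.size : ℝ) ≠ 0 := by
    have := τ.1.one_le_size
    positivity
  have h1 : |glLogTrunc (proj n x) ⟨{τ.1}, (Forest.size_singleton τ.1).trans_le τ.2⟩| ≤
      C * r ^ τ.1.size := by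
    rw [glLogTrunc_proj_apply, Finset.sum_mul]
    refine (Finset.abs_sum_le_sum_abs _ _).trans (Finset.sum_le_sum fun k _ => ?_)
    have h2 := h k (x - unit d) r hr (hx.sub (homBound_unit d n hr)) {τ.1}
      (by rw [Forest.size_singleton]; exact τ.2)
    rw [Forest.size_singleton] at h2
    rw [abs_mul]
    exact (mul_le_of_le_one_left (abs_nonneg _) (abs_neg_one_pow_div_le k)).trans h2
  calc _ ≤ (C * r ^ τ.1.size) ^ (1 / (τ.1.size : ℝ)) :=
        Real.rpow_le_rpow (abs_nonneg _) h1 (by positivity)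
    _ = C ^ (1 / (τ.1.size : ℝ)) * r := by
        rw [Real.mul_rpow hC (pow_nonneg hr _), ← Real.rpow_natCast, ← Real.rpow_mul hr,
          mul_one_div_cancel hτ, Real.rpow_one]

theorem abs_glLogTrunc_le {d n : ℕ} (g : TruncSeries d n) {K : ℝ} (hg : hNorm g ≤ K)
    (τ : TreeLE d n) :
    |glLogTrunc g ⟨{τ.1}, (Forest.size_singleton τ.1).trans_le τ.2⟩| ≤ K ^ τ.1.size := by
  have hτ : τ.1.size ≠ 0 := by
    have := τ.1.one_le_size
    omega
  have h1 := (Finset.single_le_sum (f := fun τ : TreeLE d n =>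
    |glLogTrunc g ⟨{τ.1}, (Forest.size_singleton τ.1).trans_le τ.2⟩| ^ (1 / (τ.1.size : ℝ)))
    (fun _ _ => Real.rpow_nonneg (abs_nonneg _) _) (Finset.mem_univ τ)).trans hg
  have h2 := pow_le_pow_left₀ (Real.rpow_nonneg (abs_nonneg _) _) h1 τ.1.size
  rwa [one_div, Real.rpow_inv_natCast_pow (abs_nonneg _) hτ] at h2

/-- The linear term of the logarithm at a tree is the coefficient itself; the higher powers depend
only on lower orders, so induction on the order inverts the logarithm at the level of bounds. -/
theorem exists_homBound_of_hNorm_le (d n : ℕ) {K : ℝ} (hK : 0 ≤ K) : ∃ L, 0 ≤ L ∧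
    ∀ (x : GroupLike d) (r : ℝ), 0 ≤ r → hNorm (proj n x.1) ≤ K * r → HomBound n L r x.1 := by
  have key : ∀ m, m ≤ n → ∃ L, 0 ≤ L ∧ ∀ (x : GroupLike d) (r : ℝ), 0 ≤ r →
      hNorm (proj n x.1) ≤ K * r → HomBound m L r x.1 := by
    intro m hm
    induction m with
    | zero =>
      refine ⟨1, zero_le_one, fun x r _ _ ζ hζ => ?_⟩
      rw [Forest.size_eq_zero.1 (Nat.le_zero.1 hζ), x.apply_zero]
      simp [Forest.size_zero]
    | succ m ih =>
      obtain ⟨L, hL, h⟩ := ih (by omega)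
      choose! B hB hB' using
        fun k => exists_homBound_glPow_add_two d m (K := L + 1) (by positivity) k
      -- The three terms ensure `1 ≤ C`, bound the logarithm coefficient and bound the higher
      -- powers; `max K 1` permits raising exponents to `m + 1`.
      set C := 1 + (max K 1) ^ (m + 1) + ∑ k ∈ Finset.Icc 2 n, |B k|
      have hS : 0 ≤ ∑ k ∈ Finset.Icc 2 n, |B k| := Finset.sum_nonneg fun _ _ => abs_nonneg _
      have hC : 1 ≤ C := by
        have : 0 ≤ (max K 1) ^ (m + 1) := by positivity
        linarith
      refine ⟨C ^ (m + 1), by positivity, fun x r hr hx => x.homBound_of_trees hC hr ?_⟩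
      intro τ hτ
      have hu0 : (x.1 - unit d) 0 = 0 := by simp [x.apply_zero, unit]
      have hu := (h x r hr hx).sub (homBound_unit d m hr)
      have h1 := abs_glLogTrunc_le _ hx ⟨τ, by omega⟩
      have h2 := glLogTrunc_proj_apply x.1
        (⟨{τ}, (Forest.size_singleton τ).trans_le (by omega)⟩ : ForestLE d n)
      have h3 : Finset.Icc 1 n = insert 1 (Finset.Icc 2 n) := by
        ext k
        simp only [Finset.mem_Icc, Finset.mem_insert]
        omega
      rw [h3, Finset.sum_insert (by simp)] at h2
      have h4 : glPow (x.1 - unit d) 1 {τ} = x.1 {τ} := by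
        rw [glPow, glPow, unit_glMul]
        simp [unit]
      set R := ∑ k ∈ Finset.Icc 2 n, ((-1 : ℝ) ^ (k + 1) / k) * glPow (x.1 - unit d) k {τ}
      have h5 : |R| ≤ (∑ k ∈ Finset.Icc 2 n, |B k|) * r ^ τ.size := by
        rw [Finset.sum_mul]
        refine (Finset.abs_sum_le_sum_abs _ _).trans (Finset.sum_le_sum fun k hk => ?_)
        have h6 := hB' k (Finset.mem_Icc.1 hk).1 _ r hr hu0 hu {τ}
          (by rwa [Forest.size_singleton])
        rw [Forest.size_singleton] at h6
        rw [abs_mul]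
        refine (mul_le_of_le_one_left (abs_nonneg _) (abs_neg_one_pow_div_le k)).trans
          (h6.trans ?_)
        exact mul_le_mul_of_nonneg_right (le_abs_self _) (pow_nonneg hr _)
      have h7 : (K * r) ^ τ.size ≤ (max K 1) ^ (m + 1) * r ^ τ.size := by
        rw [mul_pow]
        refine mul_le_mul_of_nonneg_right ?_ (pow_nonneg hr _)
        exact (pow_le_pow_left₀ hK (le_max_left _ _) _).trans
          (pow_le_pow_right₀ (le_max_right _ _) hτ)
      rw [h4] at h2
      have h8 : x.1 {τ} = glLogTrunc (proj n x.1)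
          ⟨{τ}, (Forest.size_singleton τ).trans_le (by omega)⟩ - R := by
        rw [h2]
        norm_num
      rw [h8]
      have h9 : 0 ≤ r ^ τ.size := pow_nonneg hr _
      refine (abs_sub _ _).trans ((add_le_add (h1.trans h7) h5).trans ?_)
      rw [← add_mul]
      exact mul_le_mul_of_nonneg_right (by linarith) h9
  exact key n le_rfl

end BranchedRP

namespace BranchedRP

/-! ### Sewing -/

open Filter Topology in
-- A Hölder exponent above 1 forces the derivative to vanish.
theorem eq_of_abs_sub_le_rpow {T C θ : ℝ} (hT : 0 ≤ T) (hθ : 1 < θ) {f : Set.Icc 0 T → ℝ}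
    (h : ∀ s t : Set.Icc 0 T, s < t → |f t - f s| ≤ C * |(t : ℝ) - s| ^ θ) (s t : Set.Icc 0 T) :
    f s = f t := by
  have h0 : ∀ s t : Set.Icc 0 T, |f t - f s| ≤ |C| * |(t : ℝ) - s| ^ θ := by
    intro s t
    rcases lt_trichotomy s t with hst | rfl | hst
    · exact (h s t hst).trans (by gcongr; exact le_abs_self C)
    · simp only [sub_self, abs_zero]; positivity
    · rw [abs_sub_comm, abs_sub_comm (t : ℝ)]
      exact (h t s hst).trans (by gcongr; exact le_abs_self C)
  -- Projection onto the interval is 1-Lipschitz, so the bound extends to the whole line.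
  set F : ℝ → ℝ := fun x => f (Set.projIcc 0 T hT x)
  have hF : ∀ x y, |F y - F x| ≤ |C| * |y - x| ^ θ := fun x y =>
    (h0 _ _).trans (mul_le_mul_of_nonneg_left (Real.rpow_le_rpow (abs_nonneg _)
      (Set.abs_projIcc_sub_projIcc hT) (by linarith)) (abs_nonneg C))
  have hd : ∀ x, HasDerivAt F 0 x := by
    intro x
    rw [hasDerivAt_iff_isLittleO]
    have h1 : (fun y => F y - F x - (y - x) • (0 : ℝ)) =O[𝓝 x] fun y => |y - x| ^ θ := by
      refine Asymptotics.IsBigO.of_bound |C| (Eventually.of_forall fun y => ?_)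
      simp only [smul_zero, sub_zero, Real.norm_eq_abs]
      rw [abs_of_nonneg (by positivity : 0 ≤ |y - x| ^ θ)]
      exact hF x y
    refine h1.trans_isLittleO ?_
    rw [Asymptotics.isLittleO_iff]
    intro c hc
    have h2 : Tendsto (fun y : ℝ => |y - x| ^ (θ - 1)) (𝓝 x) (𝓝 0) := by
      have h3 : Continuous fun y : ℝ => |y - x| ^ (θ - 1) :=
        (continuous_abs.comp (continuous_id.sub continuous_const)).rpow_const
          fun _ => Or.inr (by linarith)
      have h4 := h3.tendsto x
      simpa [Real.zero_rpow (by linarith : θ - 1 ≠ 0)] using h4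
    filter_upwards [h2.eventually_le_const hc] with y hy
    rw [Real.norm_eq_abs, Real.norm_eq_abs, abs_of_nonneg (by positivity : 0 ≤ |y - x| ^ θ)]
    by_cases hxy : |y - x| = 0
    · rw [hxy, Real.zero_rpow (by linarith)]; simp
    · have h5 : |y - x| ^ θ = |y - x| ^ (θ - 1) * |y - x| := by
        rw [Real.rpow_sub_one hxy, div_mul_cancel₀ _ hxy]
      rw [h5]
      exact mul_le_mul_of_nonneg_right hy (abs_nonneg _)
  have h6 := is_const_of_deriv_eq_zero (fun x => (hd x).differentiableAt)
    (fun x => (hd x).deriv) s t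
  simpa [F] using h6

/-- A discrete intermediate value property, used to find the partition cell that straddles the
midpoint. -/
theorem exists_le_mid_le {u : ℕ → ℝ} {i j : ℕ} (hij : i < j) {m : ℝ} (hi : u i ≤ m)
    (hj : m ≤ u j) : ∃ l, i ≤ l ∧ l < j ∧ u l ≤ m ∧ m ≤ u (l + 1) := by
  by_contra! hcon
  have : ∀ l, i ≤ l → l < j → u l ≤ m := by
    intro l hl
    induction l, hl using Nat.le_induction with
    | base => exact fun _ => hi
    | succ l hl ih => exact fun h => (hcon l hl (by omega) (ih (by omega))).le
  have h1 := hcon (j - 1) (by omega) (by omega) (this _ (by omega) (by omega))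
  rw [Nat.sub_add_cancel (by omega)] at h1
  exact absurd hj (not_le.2 h1)

section Sewing

variable {α : Type*} [LinearOrder α] {p : α → ℝ} {Ξ : α → α → ℝ} {C θ : ℝ}

/-- The sewing estimate along a finite partition. -/
theorem abs_sub_sum_le_of_almost_additive (hp : Monotone p) (hC : 0 ≤ C) (hθ : 1 < θ)
    (h : ∀ s u t, s ≤ u → u ≤ t → |Ξ s t - Ξ s u - Ξ u t| ≤ C * (p t - p s) ^ θ)
    {t : ℕ → α} (ht : Monotone t) (m i : ℕ) :
    |Ξ (t i) (t (i + m)) - ∑ k ∈ Finset.Ico i (i + m), Ξ (t k) (t (k + 1))| ≤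
      2 * C / (1 - 2 ^ (1 - θ)) * (p (t (i + m)) - p (t i)) ^ θ := by
  have hq : (2 : ℝ) ^ (1 - θ) < 1 := Real.rpow_lt_one_of_one_lt_of_neg (by norm_num) (by linarith)
  set D := 2 * C / (1 - 2 ^ (1 - θ))
  have hD : 0 ≤ D := div_nonneg (by positivity) (by linarith)
  -- `D` is the fixed point of the recursion: two splittings cost `2 * C`, and two halves cost `2 *
  -- D * 2 ^ (-θ)`.
  have hD' : 2 * C + D * 2 ^ (1 - θ) = D := by
    have : D * (1 - 2 ^ (1 - θ)) = 2 * C := div_mul_cancel₀ _ (by linarith)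
    linarith
  induction m using Nat.strong_induction_on generalizing i with
  | h m ih =>
    rcases Nat.eq_zero_or_pos m with rfl | hm
    · have h1 := h (t i) (t i) (t i) le_rfl le_rfl
      have h2 : (0 : ℝ) ^ θ = 0 := Real.zero_rpow (by linarith)
      rw [sub_self (p _), h2, mul_zero] at h1
      simpa [h2] using h1
    · have hmono : Monotone (p ∘ t) := hp.comp ht
      set a := p (t i) with ha
      set b := p (t (i + m)) with hb
      have hab : a ≤ b := hmono (Nat.le_add_right i m)
      -- Cutting out the cell around the midpoint leaves two pieces, each of `p`-length at most
      -- half.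
      obtain ⟨l, hl1, hl2, hl3, hl4⟩ := exists_le_mid_le (u := p ∘ t) (i := i) (j := i + m)
        (m := (a + b) / 2) (by omega) (by simp only [Function.comp_apply]; linarith)
        (by simp only [Function.comp_apply]; linarith)
      simp only [Function.comp_apply] at hl3 hl4
      obtain ⟨m₁, rfl⟩ := Nat.exists_eq_add_of_le hl1
      obtain ⟨m₂, hm₂⟩ := Nat.exists_eq_add_of_lt hl2
      have hm₂' : i + m = (i + m₁ + 1) + m₂ := by omega
      have e1 := ih m₁ (by omega) i
      have e2 := ih m₂ (by omega) (i + m₁ + 1)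
      rw [← hm₂'] at e2
      have e3 := h (t i) (t (i + m₁)) (t (i + m)) (ht (by omega)) (ht (by omega))
      have e4 := h (t (i + m₁)) (t (i + m₁ + 1)) (t (i + m)) (ht (by omega)) (ht (by omega))
      have hai : a ≤ p (t (i + m₁)) := hmono (by omega)
      have hib : p (t (i + m₁ + 1)) ≤ b := hmono (by omega)
      have hhalf : ((b - a) / 2) ^ θ = 2 ^ (1 - θ) * (b - a) ^ θ / 2 := by
        rw [Real.div_rpow (by linarith) (by norm_num), Real.rpow_sub (by norm_num), Real.rpow_one]
        field_simp
      have f1 : (p (t (i + m₁)) - a) ^ θ ≤ 2 ^ (1 - θ) * (b - a) ^ θ / 2 := by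
        rw [← hhalf]
        exact Real.rpow_le_rpow (by linarith) (by linarith) (by linarith)
      have f2 : (b - p (t (i + m₁ + 1))) ^ θ ≤ 2 ^ (1 - θ) * (b - a) ^ θ / 2 := by
        rw [← hhalf]
        exact Real.rpow_le_rpow (by linarith) (by linarith) (by linarith)
      have f3 : (b - p (t (i + m₁))) ^ θ ≤ (b - a) ^ θ :=
        Real.rpow_le_rpow (by linarith [hmono (by omega : i + m₁ ≤ i + m)]) (by linarith)
          (by linarith)
      have hsum : ∑ k ∈ Finset.Ico i (i + m), Ξ (t k) (t (k + 1)) =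
          ∑ k ∈ Finset.Ico i (i + m₁), Ξ (t k) (t (k + 1)) + Ξ (t (i + m₁)) (t (i + m₁ + 1)) +
            ∑ k ∈ Finset.Ico (i + m₁ + 1) (i + m), Ξ (t k) (t (k + 1)) := by
        rw [← Finset.sum_Ico_consecutive _ (by omega : i ≤ i + m₁ + 1)
          (by omega : i + m₁ + 1 ≤ i + m), Finset.sum_Ico_succ_top (by omega)]
      have g1 := mul_le_mul_of_nonneg_left f1 hD
      have g2 := mul_le_mul_of_nonneg_left f2 hD
      have g3 := mul_le_mul_of_nonneg_left f3 hC
      have g4 : D * (b - a) ^ θ =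
          2 * (C * (b - a) ^ θ) + 2 * (D * (2 ^ (1 - θ) * (b - a) ^ θ / 2)) := by
        conv_lhs => rw [← hD']
        ring
      rw [hsum, g4]
      rw [abs_le] at e1 e2 e3 e4 ⊢
      constructor <;> linarith

/-- Partial sums of `Ξ` along the sorted points of `F` work, with a constant independent of `F`. -/
theorem exists_sewing_on_finset (hp : Monotone p) (hC : 0 ≤ C) (hθ : 1 < θ)
    (h : ∀ s u t, s ≤ u → u ≤ t → |Ξ s t - Ξ s u - Ξ u t| ≤ C * (p t - p s) ^ θ)
    (F : Finset α) : ∃ x : α → ℝ, ∀ s ∈ F, ∀ t ∈ F, s ≤ t →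
      |Ξ s t - (x t - x s)| ≤ 2 * C / (1 - 2 ^ (1 - θ)) * (p t - p s) ^ θ := by
  rcases F.eq_empty_or_nonempty with rfl | hF
  · exact ⟨0, by simp⟩
  have hc : 0 < F.card := hF.card_pos
  -- The enumeration of `F` stays at its maximum after the last index, which makes it a monotone
  -- sequence on all of `ℕ`.
  set t : ℕ → α := fun k => F.orderEmbOfFin rfl ⟨min k (F.card - 1), by omega⟩
  have ht : Monotone t := fun k l hkl => by
    refine (F.orderEmbOfFin rfl).monotone ?_
    rw [Fin.mk_le_mk]
    omega
  have hsurj : ∀ s ∈ F, ∃ k, t k = s := by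
    intro s hs
    rw [← Finset.mem_coe, ← Finset.range_orderEmbOfFin F rfl] at hs
    obtain ⟨k, rfl⟩ := hs
    refine ⟨k, ?_⟩
    simp only [t]
    congr 1
    ext
    simp only
    omega
  choose! idx hidx using hsurj
  refine ⟨fun s => ∑ k ∈ Finset.range (idx s), Ξ (t k) (t (k + 1)), fun s hs u hu hsu => ?_⟩
  have key : ∀ s ∈ F, ∀ u ∈ F, idx s ≤ idx u →
      |Ξ s u - (∑ k ∈ Finset.range (idx u), Ξ (t k) (t (k + 1)) -
        ∑ k ∈ Finset.range (idx s), Ξ (t k) (t (k + 1)))| ≤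
        2 * C / (1 - 2 ^ (1 - θ)) * (p u - p s) ^ θ := by
    intro s hs u hu hle
    obtain ⟨m, hm⟩ := Nat.exists_eq_add_of_le hle
    have := abs_sub_sum_le_of_almost_additive hp hC hθ h ht m (idx s)
    rw [← hm, hidx s hs, hidx u hu, Finset.sum_Ico_eq_sub _ hle] at this
    exact this
  rcases le_total (idx s) (idx u) with hle | hle
  · exact key s hs u hu hle
  -- If the indices come in the reverse order, monotonicity of `t` forces the points to coincide.
  · have : s = u := le_antisymm hsu (by rw [← hidx s hs, ← hidx u hu]; exact ht hle)
    subst this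
    exact key s hs s hs le_rfl

open Filter Topology in
/-- The sewing lemma. -/
theorem exists_sewing {o : α} (ho : ∀ t, o ≤ t) (hp : Monotone p) (hC : 0 ≤ C) (hθ : 1 < θ)
    (h : ∀ s u t, s ≤ u → u ≤ t → |Ξ s t - Ξ s u - Ξ u t| ≤ C * (p t - p s) ^ θ) :
    ∃ x : α → ℝ, ∀ s t, s ≤ t →
      |Ξ s t - (x t - x s)| ≤ 2 * C / (1 - 2 ^ (1 - θ)) * (p t - p s) ^ θ := by
  choose y hy using exists_sewing_on_finset hp hC hθ h
  set D := 2 * C / (1 - 2 ^ (1 - θ))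
  -- Normalising at `o` keeps the values at each point in a compact interval. Limits along an
  -- ultrafilter finer than `atTop` then exist without any continuity of `Ξ`, and the estimate is
  -- closed under limits.
  set z : Finset α → α → ℝ := fun F t => y F t - y F o
  set U : Ultrafilter (Finset α) := Ultrafilter.of atTop
  have hU : ∀ s : α, ∀ᶠ F in (U : Filter (Finset α)), s ∈ F := fun s =>
    (Ultrafilter.of_le atTop) ((eventually_ge_atTop {s}).mono fun F hF =>
      hF (Finset.mem_singleton_self s))
  have hlim : ∀ t, ∃ x, Tendsto (fun F => z F t) U (𝓝 x) := by
    intro t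
    set M := D * (p t - p o) ^ θ
    have h1 : ∀ᶠ F in (U : Filter (Finset α)), z F t ∈ Set.Icc (Ξ o t - M) (Ξ o t + M) := by
      filter_upwards [hU o, hU t] with F h0 ht
      have := abs_le.1 (hy F o h0 t ht (ho t))
      constructor <;> simp only [z] <;> linarith [this.1, this.2]
    obtain ⟨x, -, hx⟩ := isCompact_Icc.ultrafilter_le_nhds' (U.map fun F => z F t) h1
    exact ⟨x, hx⟩
  choose x hx using hlim
  refine ⟨x, fun s t hst => ?_⟩
  have h1 : Tendsto (fun F => |Ξ s t - (z F t - z F s)|) U (𝓝 |Ξ s t - (x t - x s)|) :=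
    (tendsto_const_nhds.sub ((hx t).sub (hx s))).abs
  refine le_of_tendsto h1 ?_
  filter_upwards [hU s, hU t] with F hs ht
  simp only [z, sub_sub_sub_cancel_right]
  exact hy F s hs t ht hst

end Sewing

end BranchedRP

namespace BranchedRP

/-! ### Extension and uniqueness of group-like paths -/

namespace GroupLike

variable {d : ℕ}

theorem inv_congr {x x' : GroupLike d} {n : ℕ}
    (h : ∀ η, Forest.size η ≤ n → x.1 η = x'.1 η) {ζ : Forest d} (hζ : Forest.size ζ ≤ n) :
    x⁻¹.1 ζ = x'⁻¹.1 ζ := by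
  have h1 : (x⁻¹ * x').1 ζ = (x⁻¹ * x).1 ζ :=
    mul_congr (n := n) (fun _ _ => rfl) (fun η hη => (h η hη).symm) hζ
  have h2 : ∀ η, Forest.size η ≤ n → (x⁻¹ * x').1 η = (1 : GroupLike d).1 η := fun η hη => by
    rw [← inv_mul_cancel x]
    exact mul_congr (n := n) (fun _ _ => rfl) (fun η hη => (h η hη).symm) hη
  have h3 : (x⁻¹ * x' * x'⁻¹).1 ζ = (1 * x'⁻¹).1 ζ := mul_congr (n := n) h2 (fun _ _ => rfl) hζ
  rwa [mul_inv_cancel_right, one_mul] at h3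

theorem inv_apply_sub {x x' : GroupLike d} {n : ℕ}
    (h : ∀ η, Forest.size η ≤ n → x.1 η = x'.1 η) {τ : Tree d} (hτ : τ.size ≤ n + 1) :
    x⁻¹.1 {τ} - x'⁻¹.1 {τ} = -(x.1 {τ} - x'.1 {τ}) := by
  have h1 := mul_apply_sub h (fun η hη => inv_congr h hη) hτ
  rw [mul_inv_cancel, mul_inv_cancel, sub_self] at h1
  linarith

end GroupLike

variable {d : ℕ} {T γ : ℝ}

/-- The increments `X_s⁻¹ ⋆ X_t` satisfy the homogeneous bounds of exponent `γ` up to order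
`n`. -/
def LevelBound (γ : ℝ) (n : ℕ) (X : Set.Icc 0 T → GroupLike d) : Prop :=
  ∃ K, 0 ≤ K ∧ ∀ s t : Set.Icc 0 T, s < t →
    HomBound n K (|(t : ℝ) - s| ^ γ) ((X s)⁻¹ * X t).1

theorem LevelBound.congr {n : ℕ} {X X' : Set.Icc 0 T → GroupLike d}
    (h : ∀ t ζ, Forest.size ζ ≤ n → (X t).1 ζ = (X' t).1 ζ) (hX : LevelBound γ n X) :
    LevelBound γ n X' := by
  obtain ⟨K, hK, hX⟩ := hX
  refine ⟨K, hK, fun s t hst ζ hζ => ?_⟩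
  rw [← GroupLike.mul_congr (n := n) (fun η hη => GroupLike.inv_congr (h s) hη) (h t) hζ]
  exact hX s t hst ζ hζ

theorem LevelBound.mono {n m : ℕ} {X : Set.Icc 0 T → GroupLike d} (hnm : n ≤ m)
    (hX : LevelBound γ m X) : LevelBound γ n X := by
  obtain ⟨K, hK, hX⟩ := hX
  exact ⟨K, hK, fun s t hst ζ hζ => hX s t hst ζ (hζ.trans hnm)⟩

/-- The increments multiply, so their additivity defect at a tree of size `n + 1` is exactly
`glRest`, which sees only the controlled orders. -/
theorem LevelBound.exists_almost_additive {n : ℕ} (hγ : 0 ≤ γ) {X : Set.Icc 0 T → GroupLike d}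
    (hX : LevelBound γ n X) : ∃ C, 0 ≤ C ∧ ∀ τ : Tree d, τ.size = n + 1 →
      ∀ s u t : Set.Icc 0 T, s ≤ u → u ≤ t →
        |((X s)⁻¹ * X t).1 {τ} - ((X s)⁻¹ * X u).1 {τ} - ((X u)⁻¹ * X t).1 {τ}| ≤
          C * ((t : ℝ) - s) ^ (γ * (n + 1 : ℕ)) := by
  obtain ⟨K, hK, hX⟩ := hX
  have hM := cutMass_nonneg d (n + 1)
  refine ⟨cutMass d (n + 1) * (K * K), by positivity, fun τ hτ s u t hsu hut => ?_⟩
  have hst : 0 ≤ (t : ℝ) - s := sub_nonneg.2 (hsu.trans hut)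
  have hrhs : 0 ≤ cutMass d (n + 1) * (K * K) * ((t : ℝ) - s) ^ (γ * (n + 1 : ℕ)) :=
    mul_nonneg (by positivity) (Real.rpow_nonneg hst _)
  -- `LevelBound` concerns `s < t` only; in the degenerate cases the defect is 0 because the
  -- identity vanishes on trees.
  rcases hsu.eq_or_lt with rfl | hsu
  · simpa [GroupLike.one_apply_singleton] using hrhs
  rcases hut.eq_or_lt with rfl | hut
  · simpa [GroupLike.one_apply_singleton] using hrhs
  have h1 : (X s)⁻¹ * X t = ((X s)⁻¹ * X u) * ((X u)⁻¹ * X t) := by group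
  have hsu' : (s : ℝ) < u := hsu
  have hut' : (u : ℝ) < t := hut
  have h2 := (hX s u hsu).mono_scale (r' := ((t : ℝ) - s) ^ γ) hK (by positivity) (by
    rw [abs_of_nonneg (by linarith)]
    exact Real.rpow_le_rpow (by linarith) (by linarith) hγ)
  have h3 := (hX u t hut).mono_scale (r' := ((t : ℝ) - s) ^ γ) hK (by positivity) (by
    rw [abs_of_nonneg (by linarith)]
    exact Real.rpow_le_rpow (by linarith) (by linarith) hγ)
  have h4 := abs_glRest_le hK hK (Real.rpow_nonneg hst γ) h2 h3 (ζ := {τ})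
    (by rw [Forest.size_singleton, hτ])
  rw [Forest.size_singleton, hτ, ← Real.rpow_mul_natCast hst] at h4
  rw [h1, GroupLike.mul_apply_singleton]
  convert h4 using 2
  ring

/-- Subtracting the sewn function from the top-order coefficients of `X` changes the increments by
exactly its increments and leaves the sewing error, which has the required size. -/
theorem LevelBound.exists_succ (hT : 0 ≤ T) (hγ : 0 ≤ γ) {n : ℕ} (hn : 1 < γ * (n + 1 : ℕ))
    {X : Set.Icc 0 T → GroupLike d} (hX : LevelBound γ n X) :
    ∃ X' : Set.Icc 0 T → GroupLike d, LevelBound γ (n + 1) X' ∧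
      ∀ t ζ, Forest.size ζ ≤ n → (X' t).1 ζ = (X t).1 ζ := by
  obtain ⟨C, hC, hΞ⟩ := hX.exists_almost_additive hγ
  obtain ⟨K, hK, hX⟩ := hX
  have hsew := fun (τ : Tree d) (hτ : τ.size = n + 1) =>
    exists_sewing (o := (⟨0, le_rfl, hT⟩ : Set.Icc 0 T)) (fun t => t.2.1)
      (Subtype.mono_coe _) hC hn (hΞ τ hτ)
  choose! x hx using hsew
  set D := 2 * C / (1 - 2 ^ (1 - γ * (n + 1 : ℕ)))
  set X' : Set.Icc 0 T → GroupLike d := fun t => (X t).shift (n + 1) fun τ => -x τ t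
  have hX' : ∀ t ζ, Forest.size ζ ≤ n → (X' t).1 ζ = (X t).1 ζ := fun t ζ hζ =>
    (X t).shift_apply _ (by omega)
  set K' := max 1 (max K D)
  refine ⟨X', ⟨K' ^ (n + 1), by positivity, fun s t hst => ?_⟩, hX'⟩
  have hr : 0 ≤ |(t : ℝ) - s| ^ γ := by positivity
  refine GroupLike.homBound_of_trees _ (le_max_left _ _) hr fun τ hτ => ?_
  rcases hτ.lt_or_eq with h | h
  · have h1 := hX s t hst {τ} (by rw [Forest.size_singleton]; omega)
    rw [← GroupLike.mul_congr (n := n) (x := (X' s)⁻¹) (y := X' t)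
      (fun η hη => GroupLike.inv_congr (hX' s) hη) (hX' t)
      (by rw [Forest.size_singleton]; omega), Forest.size_singleton] at h1
    exact h1.trans (mul_le_mul_of_nonneg_right ((le_max_left _ _).trans (le_max_right _ _))
      (pow_nonneg hr _))
  · have h1 := GroupLike.mul_apply_sub (n := n) (x := (X' s)⁻¹) (y := X' t)
      (fun η hη => GroupLike.inv_congr (hX' s) hη) (hX' t) hτ
    rw [GroupLike.inv_apply_sub (hX' s) hτ, (X s).shift_singleton _ h,
      (X t).shift_singleton _ h] at h1
    have h2 := hx τ h s t hst.le
    have h3 : ((X' s)⁻¹ * X' t).1 {τ} = ((X s)⁻¹ * X t).1 {τ} - (x τ t - x τ s) := by linarith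
    have hst' : (s : ℝ) < t := hst
    rw [h3, h, ← Real.rpow_mul_natCast (abs_nonneg _), abs_of_pos (sub_pos.2 hst')]
    exact h2.trans (mul_le_mul_of_nonneg_right ((le_max_right _ _).trans (le_max_right _ _))
      (Real.rpow_nonneg (sub_pos.2 hst').le _))

/-- Extension of a path from order `N` to all orders. -/
theorem LevelBound.exists_extension (hT : 0 ≤ T) (hγ : 0 ≤ γ) {N : ℕ}
    (hN : 1 < γ * (N + 1 : ℕ)) {X : Set.Icc 0 T → GroupLike d} (hX : LevelBound γ N X)
    (hX0 : ∀ t : Set.Icc 0 T, (t : ℝ) = 0 → X t = 1) :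
    ∃ X' : Set.Icc 0 T → GroupLike d, (∀ t : Set.Icc 0 T, (t : ℝ) = 0 → X' t = 1) ∧
      (∀ n, LevelBound γ n X') ∧ ∀ t ζ, Forest.size ζ ≤ N → (X' t).1 ζ = (X t).1 ζ := by
  obtain ⟨Y, hY, hYX⟩ := GroupLike.exists_of_step (fun n X => LevelBound γ n X) N
    (fun n X X' h => LevelBound.congr h)
    (fun n hn X hX => hX.exists_succ hT hγ (hN.trans_le (by gcongr))) X hX
  set o : Set.Icc 0 T := ⟨0, le_rfl, hT⟩
  have ho : ∀ t : Set.Icc 0 T, (t : ℝ) = 0 → t = o := fun t ht => Subtype.ext ht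
  -- Left translation restores the starting value 1 without changing increments; orders up to `N`
  -- are unaffected because `X o = 1`.
  refine ⟨fun t => (Y o)⁻¹ * Y t, fun t ht => ?_, fun n => ?_, fun t ζ hζ => ?_⟩
  · rw [ho t ht]
    exact inv_mul_cancel (Y o)
  · obtain ⟨K, hK, h⟩ := (hY (max n N) (le_max_right _ _)).mono (le_max_left n N)
    refine ⟨K, hK, fun s t hst => ?_⟩
    have h1 : ((Y o)⁻¹ * Y s)⁻¹ * ((Y o)⁻¹ * Y t) = (Y s)⁻¹ * Y t := by group
    rw [h1]
    exact h s t hst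
  · have h1 := GroupLike.mul_congr (n := N) (fun η hη => GroupLike.inv_congr (hYX o) hη)
      (hYX t) hζ
    rwa [hX0 o rfl, inv_one, one_mul] at h1

/-- The coefficients up to order `N` determine a path. -/
theorem LevelBound.unique (hT : 0 ≤ T) {N : ℕ} (hγ : 0 ≤ γ)
    (hN : 1 < γ * (N + 1 : ℕ)) {X X' : Set.Icc 0 T → GroupLike d}
    (hX : ∀ n, LevelBound γ n X) (hX' : ∀ n, LevelBound γ n X')
    (hX0 : ∀ t : Set.Icc 0 T, (t : ℝ) = 0 → X t = 1)
    (hX0' : ∀ t : Set.Icc 0 T, (t : ℝ) = 0 → X' t = 1)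
    (h : ∀ t ζ, Forest.size ζ ≤ N → (X t).1 ζ = (X' t).1 ζ) : X = X' := by
  have key : ∀ n, N ≤ n → ∀ t ζ, Forest.size ζ ≤ n → (X t).1 ζ = (X' t).1 ζ := by
    intro n hn
    induction n, hn using Nat.le_induction with
    | base => exact h
    | succ n hn ih =>
      refine fun t ζ hζ => GroupLike.eq_of_trees_le (fun τ hτ => ?_) hζ
      rcases hτ.lt_or_eq with h1 | h1
      · exact ih t {τ} (by rw [Forest.size_singleton]; omega)
      obtain ⟨K, hK, hb⟩ := hX (n + 1)
      obtain ⟨K', hK', hb'⟩ := hX' (n + 1)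
      have h2 : ∀ s t : Set.Icc 0 T, s < t →
          |((X t).1 {τ} - (X' t).1 {τ}) - ((X s).1 {τ} - (X' s).1 {τ})| ≤
            (K + K') * |(t : ℝ) - s| ^ (γ * (n + 1 : ℕ)) := by
        intro s t hst
        -- Applied to `X t = X s * (X s)⁻¹ * X t` and likewise for `X'`: the top-order difference
        -- has increments equal to the difference of the group increments.
        have h3 := GroupLike.mul_apply_sub (n := n) (ih s) (fun η hη =>
          GroupLike.mul_congr (n := n) (fun η hη => GroupLike.inv_congr (ih s) hη) (ih t) hη) hτ
        rw [mul_inv_cancel_left, mul_inv_cancel_left] at h3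
        have h4 := hb s t hst {τ} (by rwa [Forest.size_singleton])
        have h5 := hb' s t hst {τ} (by rwa [Forest.size_singleton])
        rw [Forest.size_singleton, h1, ← Real.rpow_mul_natCast (abs_nonneg _)] at h4 h5
        rw [h3, add_sub_cancel_left, add_mul]
        exact (abs_sub _ _).trans (add_le_add h4 h5)
      have hθ : 1 < γ * (n + 1 : ℕ) := hN.trans_le (by gcongr)
      have h6 := eq_of_abs_sub_le_rpow hT hθ (f := fun t => (X t).1 {τ} - (X' t).1 {τ}) h2 t
        ⟨0, le_rfl, hT⟩
      rw [hX0 ⟨0, le_rfl, hT⟩ rfl, hX0' ⟨0, le_rfl, hT⟩ rfl, sub_self] at h6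
      exact sub_eq_zero.1 h6
  refine funext fun t => GroupLike.ext fun ζ => ?_
  exact key (max N (Forest.size ζ)) (le_max_left _ _) t ζ (le_max_right _ _)

end BranchedRP

namespace BranchedRP

variable {d : ℕ} {T γ : ℝ}

/-! ### Rough paths as paths in the group of group-like series -/

theorem abs_sub_rpow_pos {s t : Set.Icc 0 T} (hst : s ≠ t) (γ : ℝ) :
    0 < |(t : ℝ) - s| ^ γ :=
  Real.rpow_pos_of_pos (abs_pos.2 (sub_ne_zero.2 fun h => hst (Subtype.ext h.symm))) γ

theorem levelBound_iff_hNorm {n : ℕ} {X : Set.Icc 0 T → GroupLike d} :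
    LevelBound γ n X ↔ ∃ K : ℝ, ∀ s t : Set.Icc 0 T, s < t →
      hNorm (proj n ((X s)⁻¹ * X t).1) / |(t : ℝ) - s| ^ γ ≤ K := by
  constructor
  · rintro ⟨K, hK, h⟩
    obtain ⟨L, -, hL⟩ := exists_hNorm_le d n hK
    refine ⟨L, fun s t hst => ?_⟩
    rw [div_le_iff₀ (abs_sub_rpow_pos hst.ne γ)]
    exact hL _ _ (abs_sub_rpow_pos hst.ne γ).le (h s t hst)
  · rintro ⟨K, h⟩
    obtain ⟨L, hL0, hL⟩ := exists_homBound_of_hNorm_le d n (abs_nonneg K)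
    refine ⟨L, hL0, fun s t hst => hL _ _ (abs_sub_rpow_pos hst.ne γ).le ?_⟩
    rw [← div_le_iff₀ (abs_sub_rpow_pos hst.ne γ)]
    exact (h s t hst).trans (le_abs_self K)

/-- Reversing time inverts the increment, so `s > t` follows from the bound for inverses. Conversely
the constants can be summed over the finitely many forests of size at most `n`. -/
theorem levelBound_iff_forall_forest {n : ℕ} {X : Set.Icc 0 T → GroupLike d} :
    LevelBound γ n X ↔ ∀ ζ : Forest d, Forest.size ζ ≤ n → ∃ K : ℝ, ∀ s t : Set.Icc 0 T, s ≠ t →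
      |((X s)⁻¹ * X t).1 ζ| / |(t : ℝ) - s| ^ (γ * (Forest.size ζ : ℝ)) ≤ K := by
  constructor
  · rintro ⟨K, hK, h⟩ ζ hζ
    obtain ⟨L, -, hL⟩ := GroupLike.exists_homBound_inv d n hK
    refine ⟨max K L, fun s t hst => ?_⟩
    rw [div_le_iff₀ (abs_sub_rpow_pos hst _), Real.rpow_mul_natCast (abs_nonneg _)]
    have hr := (abs_sub_rpow_pos hst γ).le
    rcases lt_or_gt_of_ne hst with hst | hst
    · exact (h s t hst).mono le_rfl hr (le_max_left K L) ζ hζ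
    · have h1 := hL _ _ (by positivity) (h t s hst)
      rw [mul_inv_rev, inv_inv, abs_sub_comm] at h1
      exact h1.mono le_rfl hr (le_max_right K L) ζ hζ
  · intro h
    choose! K hK using h
    have key : ∀ η : ForestLE d n, |K η.1| ≤ ∑ ζ : ForestLE d n, |K ζ.1| := fun η =>
      Finset.single_le_sum (f := fun ζ : ForestLE d n => |K ζ.1|) (fun ζ _ => abs_nonneg (K ζ.1))
        (Finset.mem_univ η)
    refine ⟨∑ ζ : ForestLE d n, |K ζ.1|, Finset.sum_nonneg fun ζ _ => abs_nonneg (K ζ.1),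
      fun s t hst ζ hζ => ?_⟩
    have h1 := hK ζ hζ s t hst.ne
    rw [div_le_iff₀ (abs_sub_rpow_pos hst.ne _), Real.rpow_mul_natCast (abs_nonneg _)] at h1
    refine h1.trans (mul_le_mul_of_nonneg_right ?_ (pow_nonneg (abs_sub_rpow_pos hst.ne γ).le _))
    exact (le_abs_self _).trans (key ⟨ζ, hζ⟩)

theorem incr_coe (X : Set.Icc 0 T → GroupLike d) (s t : Set.Icc 0 T) :
    incr (fun t => (X t).1) s t = ((X s)⁻¹ * X t).1 := by
  rw [incr, glInv_eq]
  rfl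

theorem incrTrunc_proj {n : ℕ} (X : Set.Icc 0 T → GroupLike d) (s t : Set.Icc 0 T) :
    incrTrunc (fun t => proj n (X t).1) s t = proj n ((X s)⁻¹ * X t).1 := by
  rw [incrTrunc, glInvTrunc_proj, ← proj_glMul]
  rfl

theorem mem_fullPaths_iff {X : Set.Icc 0 T → Series d} :
    X ∈ fullPaths d T γ ↔ ∃ Y : Set.Icc 0 T → GroupLike d, X = (fun t => (Y t).1) ∧
      (∀ t : Set.Icc 0 T, (t : ℝ) = 0 → Y t = 1) ∧ ∀ n, LevelBound γ n Y := by
  constructor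
  · rintro ⟨h1, h2, h3⟩
    obtain ⟨Y, rfl⟩ : ∃ Y : Set.Icc 0 T → GroupLike d, X = fun t => (Y t).1 :=
      ⟨fun t => ⟨X t, h1 t⟩, rfl⟩
    refine ⟨Y, rfl, fun t ht => Subtype.ext (h2 t ht), fun n => levelBound_iff_hNorm.2 ?_⟩
    simpa only [incr_coe] using h3 n
  · rintro ⟨Y, rfl, h1, h2⟩
    refine ⟨fun t => (Y t).2, fun t ht => congrArg Subtype.val (h1 t ht), fun n => ?_⟩
    simpa only [incr_coe] using levelBound_iff_hNorm.1 (h2 n)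

/-- The lift of the unit is normalised so that lifted paths start at the identity. -/
theorem exists_groupLike_lift {n : ℕ} {g : TruncSeries d n}
    (h : ∃ x : GroupLike d, proj n x.1 = g) :
    ∃ x : GroupLike d, proj n x.1 = g ∧ (g = unitTrunc d n → x = 1) := by
  by_cases hg : g = unitTrunc d n
  · exact ⟨1, hg.symm, fun _ => rfl⟩
  · obtain ⟨x, hx⟩ := h
    exact ⟨x, hx, fun h => absurd h hg⟩

/-- The lift may be chosen pointwise with no regularity above `order γ`, because `LevelBound` at
that order ignores the higher coefficients. -/
theorem mem_truncPaths_iff {X : Set.Icc 0 T → TruncSeries d (order γ)} :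
    X ∈ truncPaths d T γ ↔ ∃ Y : Set.Icc 0 T → GroupLike d,
      X = (fun t => proj (order γ) (Y t).1) ∧
      (∀ t : Set.Icc 0 T, (t : ℝ) = 0 → Y t = 1) ∧ LevelBound γ (order γ) Y := by
  constructor
  · rintro ⟨h1, h2, h3⟩
    choose Y hY hY0 using fun t => exists_groupLike_lift (mem_groupLikeTrunc_iff.1 (h1 t))
    obtain rfl : (fun t => proj (order γ) (Y t).1) = X := funext hY
    refine ⟨Y, rfl, fun t ht => hY0 t (h2 t ht), levelBound_iff_hNorm.2 ?_⟩
    simpa only [incrTrunc_proj] using h3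
  · rintro ⟨Y, rfl, h1, h2⟩
    refine ⟨fun t => mem_groupLikeTrunc_iff.2 ⟨Y t, rfl⟩, fun t ht => ?_, ?_⟩
    · simp only [h1 t ht]
      rfl
    · simpa only [incrTrunc_proj] using levelBound_iff_hNorm.1 h2

/-! ### Character-valued rough paths as increments of group-valued paths -/

theorem pairing_injective : Function.Injective (pairing : Series d → Module.Dual ℝ (CK d)) :=
  fun x y h => funext fun ζ => by rw [← pairing_of x, h, pairing_of]

theorem pairing_apply_of (f : Module.Dual ℝ (CK d)) : pairing (fun ζ => f (CK.of ζ)) = f :=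
  (CK.basis d).ext fun ζ => by rw [CK.basis_apply, pairing_of]

theorem counit_of (ζ : Forest d) : CK.counit d (CK.of ζ) = unit d ζ := by
  classical
  rw [CK.counit, ← CK.basis_apply, Module.Basis.coord_apply, Module.Basis.repr_self,
    Finsupp.single_apply, unit]

theorem mem_fullChars_iff (hT : 0 ≤ T) {Z : Set.Icc 0 T → Set.Icc 0 T → Module.Dual ℝ (CK d)} :
    Z ∈ fullChars d T γ ↔ ∃ Y : Set.Icc 0 T → GroupLike d,
      Z = (fun s t => pairing ((Y s)⁻¹ * Y t).1) ∧
      (∀ t : Set.Icc 0 T, (t : ℝ) = 0 → Y t = 1) ∧ ∀ n, LevelBound γ n Y := by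
  constructor
  · rintro ⟨h1, ⟨h2, h3⟩, h4⟩
    obtain ⟨y, hy⟩ : ∃ y : Set.Icc 0 T → Set.Icc 0 T → GroupLike d,
        ∀ s t, pairing (y s t).1 = Z s t :=
      ⟨fun s t => ⟨fun ζ => Z s t (CK.of ζ), mem_groupLike_iff.2 ⟨(h1 s t).1, fun ζ₁ ζ₂ => by
        rw [CK.of_add, (h1 s t).2]⟩⟩, fun s t => pairing_apply_of (Z s t)⟩
    have hmul : ∀ s u t, y s t = y s u * y u t := fun s u t => GroupLike.ext fun ζ => by
      rw [GroupLike.coe_mul, glMul_apply, hy, hy, ← h3, ← hy, pairing_of]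
    have hone : ∀ t, y t t = 1 := fun t => GroupLike.ext fun ζ => by
      rw [GroupLike.coe_one, ← counit_of, ← h2 t, ← hy, pairing_of]
    set o : Set.Icc 0 T := ⟨0, le_rfl, hT⟩
    -- Chen's relation through the base point recovers every increment from the section at `o`.
    have hinc : ∀ s t, (y o s)⁻¹ * y o t = y s t := fun s t => by
      rw [hmul o s t, inv_mul_cancel_left]
    refine ⟨fun t => y o t, ?_, fun t ht => ?_, fun n => levelBound_iff_forall_forest.2 ?_⟩
    · funext s t
      rw [hinc, hy]
    · rw [show t = o from Subtype.ext ht]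
      exact hone o
    · intro ζ _
      obtain ⟨K, hK⟩ := h4 ζ
      refine ⟨K, fun s t hst => ?_⟩
      rw [hinc, ← pairing_of (y s t).1, hy]
      exact hK s t hst
  · rintro ⟨Y, rfl, -, h2⟩
    refine ⟨fun s t => ⟨?_, fun ζ₁ ζ₂ => ?_⟩, ⟨fun t => ?_, fun s u t ζ => ?_⟩, fun ζ => ?_⟩
    · rw [pairing_of, GroupLike.apply_zero]
    · rw [← CK.of_add, pairing_of, pairing_of, pairing_of, GroupLike.apply_add]
    · refine (CK.basis d).ext fun ζ => ?_
      beta_reduce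
      rw [inv_mul_cancel, CK.basis_apply, pairing_of, counit_of]
      rfl
    · rw [← glMul_apply, ← GroupLike.coe_mul, pairing_of, mul_assoc, mul_inv_cancel_left]
    · simpa only [pairing_of] using
        levelBound_iff_forall_forest.1 (h2 (Forest.size ζ)) ζ le_rfl

theorem pairingTrunc_of {n : ℕ} (x : TruncSeries d n) (ζ : ForestLE d n) :
    pairingTrunc x (CKTrunc.of ζ) = x ζ := by
  simp [pairingTrunc, CKTrunc.of]

theorem pairingTrunc_injective {n : ℕ} :
    Function.Injective (pairingTrunc : TruncSeries d n → Module.Dual ℝ (CKTrunc d n)) :=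
  fun x y h => funext fun ζ => by rw [← pairingTrunc_of x, h, pairingTrunc_of]

theorem CKTrunc.dual_ext {n : ℕ} {f g : Module.Dual ℝ (CKTrunc d n)}
    (h : ∀ ζ, f (CKTrunc.of ζ) = g (CKTrunc.of ζ)) : f = g :=
  Finsupp.lhom_ext' fun ζ => LinearMap.ext_ring (h ζ)

theorem counitTrunc_of {n : ℕ} (ζ : ForestLE d n) :
    CKTrunc.counit d n (CKTrunc.of ζ) = unitTrunc d n ζ := by
  classical
  have h : ζ = ForestLE.empty d n ↔ ζ.1 = 0 := Subtype.ext_iff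
  rw [CKTrunc.counit, CKTrunc.of, Finsupp.lapply_apply, Finsupp.single_apply, unitTrunc, proj,
    unit]
  simp only [h]

theorem pairingTrunc_comp_proj {n : ℕ} (x : TruncSeries d n) :
    pairingTrunc x ∘ₗ CKTrunc.proj d n = pairing (incl x) := by
  refine (CK.basis d).ext fun ζ => ?_
  rw [LinearMap.comp_apply, CKTrunc.proj, Module.Basis.constr_basis, CK.basis_apply, pairing_of]
  by_cases h : Forest.size ζ ≤ n
  · rw [dif_pos h, pairingTrunc_of, incl_apply x h]
  · rw [dif_neg h, map_zero, incl_apply_of_lt x (not_le.1 h)]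

theorem tensorDual_pairingTrunc {n : ℕ} (x y : TruncSeries d n) (ζ : ForestLE d n) :
    tensorDual (pairingTrunc x ∘ₗ CKTrunc.proj d n) (pairingTrunc y ∘ₗ CKTrunc.proj d n)
      (CK.coprod d (CK.of ζ.1)) = glMulTrunc x y ζ := by
  rw [pairingTrunc_comp_proj, pairingTrunc_comp_proj, ← glMul_apply]
  rfl

theorem mem_truncChars_iff (hT : 0 ≤ T)
    {Z : Set.Icc 0 T → Set.Icc 0 T → Module.Dual ℝ (CKTrunc d (order γ))} :
    Z ∈ truncChars d T γ ↔ ∃ Y : Set.Icc 0 T → GroupLike d,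
      Z = (fun s t => pairingTrunc (proj (order γ) ((Y s)⁻¹ * Y t).1)) ∧
      (∀ t : Set.Icc 0 T, (t : ℝ) = 0 → Y t = 1) ∧ LevelBound γ (order γ) Y := by
  constructor
  · rintro ⟨h1, ⟨h2, h3⟩, h4⟩
    obtain ⟨z, rfl⟩ : ∃ z : Set.Icc 0 T → Set.Icc 0 T → TruncSeries d (order γ),
        (fun s t => pairingTrunc (z s t)) = Z :=
      ⟨fun s t ζ => Z s t (CKTrunc.of ζ), funext fun s => funext fun t =>
        CKTrunc.dual_ext fun ζ => pairingTrunc_of _ ζ⟩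
    simp only [pairingTrunc_of, tensorDual_pairingTrunc] at h1 h3 h4
    have hmul : ∀ s u t, z s t = glMulTrunc (z s u) (z u t) := fun s u t => funext (h3 s u t)
    have hone : ∀ t, z t t = unitTrunc d (order γ) := fun t => funext fun ζ => by
      rw [← counitTrunc_of, ← h2 t, pairingTrunc_of]
    set o : Set.Icc 0 T := ⟨0, le_rfl, hT⟩
    -- Only the section at `o` is lifted; the other increments agree after projection by Chen's
    -- relation.
    choose Y hY hY0 using fun t =>
      exists_groupLike_lift (exists_groupLike_of_mul (h1 o t).1 (h1 o t).2)
    have hinc : ∀ s t, proj (order γ) ((Y s)⁻¹ * Y t).1 = z s t := fun s t => by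
      rw [GroupLike.coe_mul, proj_glMul, hY, hmul o s t, ← hY s, ← glMulTrunc_assoc,
        ← proj_glMul, ← GroupLike.coe_mul, inv_mul_cancel]
      exact unitTrunc_glMulTrunc _
    refine ⟨Y, ?_, fun t ht => ?_, levelBound_iff_forall_forest.2 fun ζ hζ => ?_⟩
    · funext s t
      rw [hinc]
    · refine hY0 t ?_
      rw [show t = o from Subtype.ext ht]
      exact hone o
    · obtain ⟨K, hK⟩ := h4 ⟨ζ, hζ⟩
      refine ⟨K, fun s t hst => ?_⟩
      have h5 : ((Y s)⁻¹ * Y t).1 ζ = z s t ⟨ζ, hζ⟩ := congrFun (hinc s t) ⟨ζ, hζ⟩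
      rw [h5]
      exact hK s t hst
  · rintro ⟨Y, rfl, -, h2⟩
    refine ⟨fun s t => ⟨?_, fun ζ₁ ζ₂ h => ?_⟩, ⟨fun t => ?_, fun s u t ζ => ?_⟩, fun ζ => ?_⟩
    · rw [pairingTrunc_of]
      exact GroupLike.apply_zero _
    · rw [pairingTrunc_of, pairingTrunc_of, pairingTrunc_of]
      exact GroupLike.apply_add _ _ _
    · refine CKTrunc.dual_ext fun ζ => ?_
      beta_reduce
      rw [inv_mul_cancel, pairingTrunc_of, counitTrunc_of]
      rfl
    · rw [tensorDual_pairingTrunc, pairingTrunc_of, ← proj_glMul, ← GroupLike.coe_mul, mul_assoc,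
        mul_inv_cancel_left]
    · simpa only [pairingTrunc_of, proj] using levelBound_iff_forall_forest.1 h2 ζ.1 ζ.2

/-! ### The comparison maps -/

/-- The exponent condition that lets both sewing and uniqueness start at `order γ`. -/
theorem one_lt_mul_order_add_one (hγ : 0 < γ) : 1 < γ * (order γ + 1 : ℕ) := by
  have h := Nat.lt_floor_add_one (1 / γ)
  rw [div_lt_iff₀ hγ, mul_comm] at h
  rw [order]
  exact_mod_cast h

theorem pairFullMap_coe (Y : Set.Icc 0 T → GroupLike d) :
    pairFullMap d T (fun t => (Y t).1) = fun s t => pairing ((Y s)⁻¹ * Y t).1 := by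
  funext s t
  rw [pairFullMap, incr_coe]

theorem pairTruncMap_proj (Y : Set.Icc 0 T → GroupLike d) :
    pairTruncMap d T γ (fun t => proj (order γ) (Y t).1) =
      fun s t => pairingTrunc (proj (order γ) ((Y s)⁻¹ * Y t).1) := by
  funext s t
  rw [pairTruncMap, incrTrunc_proj]

theorem bijOn_truncMap (hT : 0 ≤ T) (hγ : 0 < γ) :
    Set.BijOn (truncMap d T γ) (fullPaths d T γ) (truncPaths d T γ) := by
  have hN := one_lt_mul_order_add_one hγ
  refine ⟨fun X hX => ?_, fun X hX X' hX' h => ?_, fun X hX => ?_⟩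
  · obtain ⟨Y, rfl, h1, h2⟩ := mem_fullPaths_iff.1 hX
    exact mem_truncPaths_iff.2 ⟨Y, rfl, h1, h2 _⟩
  · obtain ⟨Y, rfl, h1, h2⟩ := mem_fullPaths_iff.1 hX
    obtain ⟨Y', rfl, h1', h2'⟩ := mem_fullPaths_iff.1 hX'
    rw [LevelBound.unique hT hγ.le hN h2 h2' h1 h1'
      fun t ζ hζ => congrFun (congrFun h t) ⟨ζ, hζ⟩]
  · obtain ⟨Y, rfl, h1, h2⟩ := mem_truncPaths_iff.1 hX
    obtain ⟨Y', h1', h2', h3⟩ := h2.exists_extension hT hγ.le hN h1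
    exact ⟨fun t => (Y' t).1, mem_fullPaths_iff.2 ⟨Y', rfl, h1', h2'⟩,
      funext fun t => funext fun ζ => h3 t ζ.1 ζ.2⟩

theorem bijOn_pairTruncMap (hT : 0 ≤ T) :
    Set.BijOn (pairTruncMap d T γ) (truncPaths d T γ) (truncChars d T γ) := by
  refine ⟨fun X hX => ?_, fun X hX X' hX' h => ?_, fun Z hZ => ?_⟩
  · obtain ⟨Y, rfl, h1, h2⟩ := mem_truncPaths_iff.1 hX
    exact (mem_truncChars_iff hT).2 ⟨Y, pairTruncMap_proj Y, h1, h2⟩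
  · obtain ⟨Y, rfl, h1, -⟩ := mem_truncPaths_iff.1 hX
    obtain ⟨Y', rfl, h1', -⟩ := mem_truncPaths_iff.1 hX'
    rw [pairTruncMap_proj, pairTruncMap_proj] at h
    funext t
    -- The increment from time 0 is the path itself, since the path starts at 1.
    have h2 := pairingTrunc_injective (congrFun (congrFun h ⟨0, le_rfl, hT⟩) t)
    rwa [h1 _ rfl, h1' _ rfl, inv_one, one_mul, one_mul] at h2
  · obtain ⟨Y, rfl, h1, h2⟩ := (mem_truncChars_iff hT).1 hZ
    exact ⟨_, mem_truncPaths_iff.2 ⟨Y, rfl, h1, h2⟩, pairTruncMap_proj Y⟩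

theorem bijOn_pairFullMap (hT : 0 ≤ T) :
    Set.BijOn (pairFullMap d T) (fullPaths d T γ) (fullChars d T γ) := by
  refine ⟨fun X hX => ?_, fun X hX X' hX' h => ?_, fun Z hZ => ?_⟩
  · obtain ⟨Y, rfl, h1, h2⟩ := mem_fullPaths_iff.1 hX
    exact (mem_fullChars_iff hT).2 ⟨Y, pairFullMap_coe Y, h1, h2⟩
  · obtain ⟨Y, rfl, h1, -⟩ := mem_fullPaths_iff.1 hX
    obtain ⟨Y', rfl, h1', -⟩ := mem_fullPaths_iff.1 hX'
    rw [pairFullMap_coe, pairFullMap_coe] at h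
    funext t
    have h2 := pairing_injective (congrFun (congrFun h ⟨0, le_rfl, hT⟩) t)
    rwa [h1 _ rfl, h1' _ rfl, inv_one, one_mul, one_mul] at h2
  · obtain ⟨Y, rfl, h1, h2⟩ := (mem_fullChars_iff hT).1 hZ
    exact ⟨_, mem_fullPaths_iff.2 ⟨Y, rfl, h1, h2⟩, pairFullMap_coe Y⟩

end BranchedRP

theorem mainTheorem2 (d : ℕ) (T γ : ℝ) (hT : 0 ≤ T) (hγ₀ : 0 < γ) (hγ₁ : γ < 1) :
    Set.BijOn (BranchedRP.truncMap d T γ)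
        (BranchedRP.fullPaths d T γ) (BranchedRP.truncPaths d T γ) ∧
      Set.BijOn (BranchedRP.pairTruncMap d T γ)
        (BranchedRP.truncPaths d T γ) (BranchedRP.truncChars d T γ) ∧
      Set.BijOn (BranchedRP.pairFullMap d T)
        (BranchedRP.fullPaths d T γ) (BranchedRP.fullChars d T γ) := by
  exact ⟨BranchedRP.bijOn_truncMap hT hγ₀, BranchedRP.bijOn_pairTruncMap hT,
    BranchedRP.bijOn_pairFullMap hT⟩
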